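/- **Simon functions.** For $n\ge 1$, a Simon function with period $s\in\{0,1\}^n\setminus\{0^n\}$ is a two-to-one function $f:\{0,1\}^n\to\{0,1\}^n$ with $f(x\oplus s)=f(x)$ for all $x$. **The random $d$-Serial Simon's oracle of size $n$.** Sample $d+1$ independent pairs $(f_i,s_i)$, $i=0,\dots,d$, each uniform among all pairs of a Simon function on $\{0,1\}^n$ and its period. Define $L_0,\dots,L_d:\{0,1\}^n\times\{0,1\}^n\to\{0,1\}^n\cup\{\perp\}$ by $L_0(x,z)=f_0(x)$ and, for $1\le i\le d$, $L_i(x,z)=f_i(x)$ if $z=s_{i-1}$ and $L_i(x,z)=\perp$ otherwise. The oracle $\mathcal L$ is the standard oracle of $(L_0,\dots,L_d)$: a classical query $(i,x,z)$ returns $L_i(x,z)$, and a quantum query to $L_i$ acts as $|x,z\rangle|a\rangle\mapsto|x,z\rangle|a\oplus L_i(x,z)\rangle$, where $\{0,1\}^n\cup\{\perp\}$ is encoded by $n+1$ bits. Let $s=s_d$ be the period of the last function. **$\mathrm{QC}_d$ circuits with oracle access.** Such a circuit acts on a register of qubits and a register of classical bits, all initially $0$. It consists of $d$ rounds, followed by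 a final classical circuit with oracle access, some of whose bits are the output. One round consists, in this order, of: a classical circuit (NAND gates and oracle gates) on the classical bits; a single layer of one- and two-qubit gates on disjoint qubits, which may be chosen depending on the classical bits; a parallel oracle call, that is, any number of quantum queries to sub-oracles $L_i$ on disjoint qubits; a computational basis measurement of some of the qubits, whose outcomes are stored in classical bits. The unmeasured qubits stay coherent between the rounds. **Theorem.** Let $d=d(n)$ be bounded by a polynomial in $n$ (for example, constant). For each $n$ let $\mathcal B_n$ be a $\mathrm{QC}_{d(n)}$ circuit with access to a $d(n)$-Serial Simon's oracle of size $n$ and with $n$ output bits, such that the number of qubits, the number of classical bits and the size of each classical circuit of $\mathcal B_n$ are at most $p(n)$ for some polynomial $p$. Then the probability, over the random oracle $\mathcal L$ and the measurements, that $\mathcal B_n^{\mathcal L}$ outputs $s$ is exponentially small (in particular negligible): there is a constant $c>0$ such that for all sufficiently large $n$ $$\Pr\bigl[s\leftarrow\mathcal B_n^{\mathcal L}\bigr]\le 2^{-cn}.$$ -/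

import Mathlib

namespace SerialSimon

/-! ## Bit strings, standard oracles, classical oracle circuits -/

/-- Bit strings of length `n`. Pointwise addition in `ZMod 2` is the bitwise XOR. -/
abbrev Bits (n : ℕ) : Type := Fin n → ZMod 2

/-- A standard oracle: a family of Boolean functions (the sub-oracles), indexed by `ι`, each of which
maps `m` bits to `k` bits. -/
abbrev Oracle (ι : Type) (m k : ℕ) : Type := ι → Bits m → Bits k

/-- A gate of a classical circuit on `b` bits with access to an oracle: either a NAND gate, which
overwrites the bit `t` with the NAND of the bits `a₁` and `a₂`, or an oracle gate, which queries the
sub-oracle `i` on the bits selected by `inp` and overwrites the bits selected by `out` with the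
answer. -/
inductive ClassicalGate (ι : Type) (m k b : ℕ) : Type where
  | nand (a₁ a₂ t : Fin b)
  | query (i : ι) (inp : Fin m → Fin b) (out : Fin k ↪ Fin b)

/-- The action of a classical gate on the values of the `b` bits. -/
noncomputable def ClassicalGate.run {ι : Type} {m k b : ℕ} (O : Oracle ι m k) :
    ClassicalGate ι m k b → Bits b → Bits b
  | .nand a₁ a₂ t, c => Function.update c t (1 + c a₁ * c a₂)
  | .query i inp out, c => Function.extend out (O i (fun j => c (inp j))) c

/-- A classical circuit on `b` bits with oracle access; its size is the length of the list. -/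
abbrev ClassicalCircuit (ι : Type) (m k b : ℕ) : Type := List (ClassicalGate ι m k b)

/-- A classical circuit applies its gates one after the other, from the head of the list on. -/
noncomputable def ClassicalCircuit.run {ι : Type} {m k b : ℕ} (O : Oracle ι m k)
    (A : ClassicalCircuit ι m k b) (c : Bits b) : Bits b :=
  A.foldl (fun c g => g.run O c) c

/-! ## Single layer unitaries and parallel oracle calls on `q` qubits -/

/-- A (possibly unnormalised) pure state of `q` qubits, by its amplitudes in the computational
basis. -/
abbrev QState (q : ℕ) : Type := Bits q → ℂ

/-- A one-qubit or two-qubit gate, acting on the given qubits of a `q`-qubit register. -/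
inductive Gate (q : ℕ) : Type where
  | one (a : Fin q) (U : Matrix.unitaryGroup (ZMod 2) ℂ)
  | two (a b : Fin q) (hab : a ≠ b) (U : Matrix.unitaryGroup (ZMod 2 × ZMod 2) ℂ)

/-- The qubits on which a gate acts. -/
def Gate.support {q : ℕ} : Gate q → Finset (Fin q)
  | .one a _ => {a}
  | .two a b _ _ => {a, b}

/-- The action of a gate on states (identity on the other qubits). -/
noncomputable def Gate.apply {q : ℕ} : Gate q → QState q → QState q
  | .one a U, ψ => fun x =>
      ∑ v : ZMod 2, (U : Matrix (ZMod 2) (ZMod 2) ℂ) (x a) v * ψ (Function.update x a v)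
  | .two a b _ U, ψ => fun x =>
      ∑ v : ZMod 2 × ZMod 2, (U : Matrix (ZMod 2 × ZMod 2) (ZMod 2 × ZMod 2) ℂ) (x a, x b) v *
        ψ (Function.update (Function.update x a v.1) b v.2)

/-- A single layer unitary: one-qubit and two-qubit gates that act on disjoint qubits. -/
structure Layer (q : ℕ) : Type where
  gates : List (Gate q)
  disjoint : gates.Pairwise fun g h => Disjoint g.support h.support

/-- The action of a single layer unitary (the gates commute, so that their order is irrelevant). -/
noncomputable def Layer.apply {q : ℕ} (U : Layer q) (ψ : QState q) : QState q :=
  U.gates.foldl (fun ψ g => g.apply ψ) ψ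

/-- One quantum query to the sub-oracle `index`: `wires` selects distinct qubits, `m` of them for the
query register and `k` of them for the response register. -/
structure Query (ι : Type) (m k q : ℕ) : Type where
  index : ι
  wires : Fin m ⊕ Fin k ↪ Fin q

/-- The qubits on which a query acts. -/
def Query.support {ι : Type} {m k q : ℕ} (Q : Query ι m k q) : Finset (Fin q) :=
  Finset.univ.map Q.wires

/-- The action of a query on basis states, `|x⟩|a⟩ ↦ |x⟩|a ⊕ f(x)⟩` on query and response register
and the identity on the remaining qubits. -/
noncomputable def Query.basisMap {ι : Type} {m k q : ℕ} (O : Oracle ι m k) (Q : Query ι m k q)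
    (y : Bits q) : Bits q :=
  fun w => y w + ∑ j : Fin k,
    if Q.wires (Sum.inr j) = w then O Q.index (fun l => y (Q.wires (Sum.inl l))) j else 0

/-- The linear extension of `Query.basisMap`. As `Query.basisMap` is an involution, the amplitude of
`y` in the new state is the amplitude of `Query.basisMap O Q y` in the old one. -/
noncomputable def Query.apply {ι : Type} {m k q : ℕ} (O : Oracle ι m k) (Q : Query ι m k q)
    (ψ : QState q) : QState q :=
  fun y => ψ (Q.basisMap O y)

/-- A parallel oracle call: any number of queries, to any of the sub-oracles, that act on disjoint
qubits. -/
structure OracleLayer (ι : Type) (m k q : ℕ) : Type where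
  queries : List (Query ι m k q)
  disjoint : queries.Pairwise fun Q R => Disjoint Q.support R.support

/-- The action of a parallel oracle call. -/
noncomputable def OracleLayer.apply {ι : Type} {m k q : ℕ} (O : Oracle ι m k)
    (L : OracleLayer ι m k q) (ψ : QState q) : QState q :=
  L.queries.foldl (fun ψ Q => Q.apply O ψ) ψ

/-! ## QC circuits with oracle access -/

/-- One round of a QC circuit with oracle access on `q` qubits and `b` classical bits:
a classical circuit with classical oracle access, then a single layer unitary, which may be chosen
depending on the classical bits, then a parallel quantum oracle call, then a computational basis
measurement of some of the qubits. If `readout j = some a`, then the qubit `a` is measured and the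
outcome is stored in the classical bit `j`; if `readout j = none`, then the classical bit `j` is
kept. The qubits outside the range of `readout` are not measured. -/
structure QCRound (ι : Type) (m k q b : ℕ) : Type where
  classical : ClassicalCircuit ι m k b
  unitary : Bits b → Layer q
  oracleCall : OracleLayer ι m k q
  readout : Fin b → Option (Fin q)

/-- The classical bits after the measurement, if they were `c` before it and the qubits were found in
the basis state `x`. -/
def QCRound.record {ι : Type} {m k q b : ℕ} (r : QCRound ι m k q b) (c : Bits b) (x : Bits q) :
    Bits b :=
  fun j => (r.readout j).elim (c j) x

/-- A QC circuit with `d` quantum layers and oracle access, on `qubits` qubits and `bits` classical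
bits, with an output of `n` bits: `d` rounds and a final classical circuit, after which the classical
bits selected by `output` are the output. -/
structure QCCircuit (ι : Type) (m k d n : ℕ) : Type where
  qubits : ℕ
  bits : ℕ
  rounds : Fin d → QCRound ι m k qubits bits
  final : ClassicalCircuit ι m k bits
  output : Fin n → Fin bits

/-- The joint probability that the remaining rounds are run from the classical bits `c` and the
unnormalised state `ψ` of the qubits (whose squared norm is the probability of having reached this
branch) and that the output is `t`. In each round, the sum is over the classical bits `c'` after the
measurement, and the state is projected onto the corresponding measurement outcome. -/
noncomputable def runProb {ι : Type} {m k q b n : ℕ} (O : Oracle ι m k)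
    (final : ClassicalCircuit ι m k b) (output : Fin n → Fin b) (t : Bits n) :
    List (QCRound ι m k q b) → Bits b → QState q → ℝ
  | [], c, ψ =>
      if (fun j => final.run O c (output j)) = t then ∑ x : Bits q, ‖ψ x‖ ^ 2 else 0
  | r :: rs, c, ψ =>
      let c₁ := r.classical.run O c
      let φ := r.oracleCall.apply O ((r.unitary c₁).apply ψ)
      ∑ c' : Bits b, runProb O final output t rs c'
        (fun x => if r.record c₁ x = c' then φ x else 0)

/-- The probability that a QC circuit with access to the oracle `O`, started with all qubits and all
classical bits zero, outputs `t`. -/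
noncomputable def QCCircuit.outputProb {ι : Type} {m k d n : ℕ} (C : QCCircuit ι m k d n)
    (O : Oracle ι m k) (t : Bits n) : ℝ :=
  runProb O C.final C.output t (List.ofFn C.rounds) 0 (Pi.single 0 1)

/-- The circuit acts on at most `N` qubits and at most `N` classical bits and each of its classical
circuits has size at most `N`. -/
def QCCircuit.SizeAtMost {ι : Type} {m k d n : ℕ} (C : QCCircuit ι m k d n) (N : ℕ) : Prop :=
  C.qubits ≤ N ∧ C.bits ≤ N ∧ (∀ i, (C.rounds i).classical.length ≤ N) ∧ C.final.length ≤ N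

/-! ## The serial Simon's oracle -/

/-- `f` is a Simon function with period `s`: a two-to-one function with `f (x ⊕ s) = f x`, that is,
the nonempty fibres of `f` are the pairs `{x, x ⊕ s}`, and `s` is not zero. -/
def IsSimon {n : ℕ} (f : Bits n → Bits n) (s : Bits n) : Prop :=
  s ≠ 0 ∧ ∀ x y, f x = f y ↔ y = x ∨ y = x + s

/-- The pairs of a Simon function on `n` bits and its period. -/
structure SimonSample (n : ℕ) : Type where
  fn : Bits n → Bits n
  period : Bits n
  isSimon : IsSimon fn period

theorem SimonSample.injective_pair (n : ℕ) :
    Function.Injective fun p : SimonSample n => (p.fn, p.period) := by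
  rintro ⟨f, s, h⟩ ⟨f', s', h'⟩ heq
  simp only [Prod.mk.injEq] at heq
  obtain ⟨rfl, rfl⟩ := heq
  rfl

noncomputable instance (n : ℕ) : Fintype (SimonSample n) :=
  Fintype.ofInjective _ (SimonSample.injective_pair n)

/-- The sample space of the `d`-serial Simon's oracle: `d + 1` Simon functions with their periods.
The uniform distribution on it is that of `d + 1` independent uniform samples. -/
abbrev SerialSample (d n : ℕ) : Type := Fin (d + 1) → SimonSample n

/-- The functions `L₀, …, L_d` with `L₀(x, z) = f₀(x)` and, for `i ≥ 1`, `L_i(x, z) = f_i(x)` if `z`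
is the period of `f_{i-1}` and `L_i(x, z) = ⊥` otherwise. Here `⊥` is `none`. -/
def serialFun {d n : ℕ} (ω : SerialSample d n) (i : Fin (d + 1)) (x z : Bits n) :
    Option (Bits n) :=
  Fin.cases (some ((ω 0).fn x))
    (fun j : Fin d => if z = (ω j.castSucc).period then some ((ω j.succ).fn x) else none) i

/-- The encoding of `{0,1}ⁿ ∪ {⊥}` by `n + 1` bits: `y` becomes `1y` and `⊥` becomes `0…0`. -/
def encode {n : ℕ} : Option (Bits n) → Bits (n + 1)
  | none => 0
  | some y => Fin.cons 1 y

/-- The `d`-serial Simon's oracle: the standard oracle of the functions `L₀, …, L_d`, whose query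
consists of the `n` bits of `x` followed by the `n` bits of `z`. -/
def serialOracle {d n : ℕ} (ω : SerialSample d n) : Oracle (Fin (d + 1)) (n + n) (n + 1) :=
  fun i w => encode (serialFun ω i (fun j => w (Fin.castAdd n j)) (fun j => w (Fin.natAdd n j)))

/-- The probability, over a uniformly random sample `ω` and the measurements, that the circuit with
access to the `d`-serial Simon's oracle of `ω` outputs the period of the last Simon function. -/
noncomputable def successProb {d n : ℕ}
    (C : QCCircuit (Fin (d + 1)) (n + n) (n + 1) d n) : ℝ :=
  (∑ ω : SerialSample d n, C.outputProb (serialOracle ω) (ω (Fin.last d)).period) /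
    Fintype.card (SerialSample d n)

end SerialSimon

/-!
Each Simon function is locked behind the period of its predecessor, and a period can only be found by
a quantum call. The `d` quantum layers are therefore used up by the first `d` of the `d + 1` functions,
and the last one is left to the final classical circuit, which cannot find its period.

The formal argument is a backward induction over the rounds (`sum_runProb_le`). The claim for the
rounds from the `j`-th one on is: if the classical bits and the state at the beginning of round `j`
depend on the Simon functions `f₀, …, f_{j-1}` only, then the probability that the remaining rounds
find the period `s_d` is small, on average over the sample. For the induction step, round `j` is
compared with the same round in which the sub-oracles `L_{j+1}, L_{j+2}, …` always answer `⊥`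
(`truncOracle`). After that round, classical bits and state depend on `f₀, …, f_j` only, so that the
induction hypothesis applies. The two rounds differ only if one of the periods `s_k` with `j ≤ k`
occurs in a query to `L_{k+1}`, classical or quantum. Up to the quantum call, however, the circuit
has had only classical access to `f_k`, and at few points.

The core estimate is thus that few values of a Simon function hide its period (`sum_score_le`): if
neither `a` nor `b` is a difference of two of the queried points, then some permutation of
`{0,1}ⁿ` fixes the queried points and turns the Simon functions with period `a` into those with
period `b` (`exists_perm_fixing`). The permutation exists since the queried points extend to a common
transversal of the pairs `{y, y + a}` and of the pairs `{y, y + b}` (`exists_common_transversal`).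
Hence every guess that is made from the values at the queried points is as likely to hit any other
admissible period. Applied gate by gate, the same estimate bounds the probability of querying a
collision (`sum_collision_le`).

The errors of the rounds are added up at the level of squared norms. The output probability is a
positive semidefinite quadratic form in the state, bounded by the squared norm, so that its value at
`φ + ψ` is at most `1 + l` times its value at `φ` plus `1 + l⁻¹` times the squared norm of `ψ`
(`runProb_add_le_weighted`). With `l = 1 / (d + 1)` the factors `1 + l` multiply to at most `e`, and
the total is a polynomial in `n` over `2 ^ n - 1 - T ^ 2`, where `T` bounds the size of the circuit.
-/

namespace SerialSimon

open scoped Pointwise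

/-! ### Squared norms and the quantum operations -/

/-- The squared norm of an unnormalised state. -/
noncomputable def QState.normSq {q : ℕ} (ψ : QState q) : ℝ := ∑ x, ‖ψ x‖ ^ 2

theorem QState.normSq_nonneg {q : ℕ} (ψ : QState q) : 0 ≤ ψ.normSq :=
  Finset.sum_nonneg fun _ _ => by positivity

theorem norm_add_sq_le_weighted {E : Type*} [SeminormedAddCommGroup E] (a b : E) {l : ℝ}
    (hl : 0 < l) : ‖a + b‖ ^ 2 ≤ (1 + l) * ‖a‖ ^ 2 + (1 + l⁻¹) * ‖b‖ ^ 2 := by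
  have h1 : ‖a + b‖ ^ 2 ≤ (‖a‖ + ‖b‖) ^ 2 := by gcongr; exact norm_add_le a b
  have h2 : 0 ≤ l⁻¹ * (l * ‖a‖ - ‖b‖) ^ 2 := by positivity
  have h3 : l⁻¹ * (l * ‖a‖ - ‖b‖) ^ 2 = l * ‖a‖ ^ 2 - 2 * ‖a‖ * ‖b‖ + l⁻¹ * ‖b‖ ^ 2 := by
    field_simp
    ring
  linarith

theorem QState.normSq_add_le_weighted {q : ℕ} (φ ψ : QState q) {l : ℝ} (hl : 0 < l) :
    (φ + ψ).normSq ≤ (1 + l) * φ.normSq + (1 + l⁻¹) * ψ.normSq := by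
  simp only [QState.normSq, Finset.mul_sum, ← Finset.sum_add_distrib]
  exact Finset.sum_le_sum fun x _ => norm_add_sq_le_weighted _ _ hl

theorem sum_norm_sq_unitary_mulVec {V : Type*} [Fintype V] [DecidableEq V]
    (U : Matrix.unitaryGroup V ℂ) (w : V → ℂ) :
    ∑ u, ‖∑ v, (U : Matrix V V ℂ) u v * w v‖ ^ 2 = ∑ v, ‖w v‖ ^ 2 := by
  have key : ∀ w : V → ℂ, ((∑ v, ‖w v‖ ^ 2 : ℝ) : ℂ) = star w ⬝ᵥ w := by
    intro w
    simp [dotProduct, Complex.conj_mul']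
  have hU : star (U : Matrix V V ℂ) * (U : Matrix V V ℂ) = 1 := Matrix.UnitaryGroup.star_mul_self U
  have h : ((∑ u, ‖((U : Matrix V V ℂ).mulVec w) u‖ ^ 2 : ℝ) : ℂ) = ((∑ v, ‖w v‖ ^ 2 : ℝ) : ℂ) := by
    rw [key, key, Matrix.star_mulVec, Matrix.dotProduct_mulVec, Matrix.vecMul_vecMul,
      ← Matrix.star_eq_conjTranspose, hU, Matrix.vecMul_one]
  exact_mod_cast h

/-- A unitary matrix acting on a part of a register preserves the squared norm. The part is given by
its reading `get` and its overwriting `set`, subject to the usual laws. -/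
theorem sum_norm_sq_unitary_local {X V : Type*} [Fintype X] [Fintype V] [DecidableEq V] [Nonempty V]
    (get : X → V) (set : X → V → X) (get_set : ∀ x v, get (set x v) = v)
    (set_set : ∀ x v w, set (set x v) w = set x w) (set_get : ∀ x, set x (get x) = x)
    (U : Matrix.unitaryGroup V ℂ) (ψ : X → ℂ) :
    ∑ x, ‖∑ v, (U : Matrix V V ℂ) (get x) v * ψ (set x v)‖ ^ 2 = ∑ x, ‖ψ x‖ ^ 2 := by
  -- Averaging over all overwritten values counts each register value `|V|` times.
  have avg : ∀ F : X → ℝ, ∑ x, ∑ v, F (set x v) = Fintype.card V * ∑ x, F x := by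
    intro F
    let e : X × V ≃ X × V :=
      { toFun := fun p => (set p.1 p.2, get p.1)
        invFun := fun p => (set p.1 p.2, get p.1)
        left_inv := fun p => by simp [set_set, get_set, set_get]
        right_inv := fun p => by simp [set_set, get_set, set_get] }
    rw [← Fintype.sum_prod_type' (f := fun x v => F (set x v)),
      ← Equiv.sum_comp e fun p : X × V => F (set p.1 p.2)]
    simp [e, set_set, set_get, Fintype.sum_prod_type, Finset.mul_sum]
  have hc : (Fintype.card V : ℝ) ≠ 0 := by simp
  apply mul_left_cancel₀ hc
  rw [← avg, ← avg]
  refine Finset.sum_congr rfl fun x _ => ?_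
  simp only [get_set, set_set]
  exact sum_norm_sq_unitary_mulVec U fun v => ψ (set x v)

theorem Gate.normSq_apply {q : ℕ} (g : Gate q) (ψ : QState q) :
    (g.apply ψ).normSq = ψ.normSq := by
  cases g with
  | one a U =>
    exact sum_norm_sq_unitary_local (fun x : Bits q => x a) (fun x v => Function.update x a v)
      (by simp) (by simp) (by simp) U ψ
  | two a b hab U =>
    refine sum_norm_sq_unitary_local (fun x : Bits q => (x a, x b))
      (fun x v => Function.update (Function.update x a v.1) b v.2) ?_ ?_ ?_ U ψ
    · rintro x ⟨v, w⟩
      simp [hab]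
    · rintro x ⟨v, w⟩ ⟨v', w'⟩
      ext i
      by_cases hi : i = b <;> by_cases hj : i = a <;> simp_all
    · intro x
      simp

theorem Gate.apply_add {q : ℕ} (g : Gate q) (φ ψ : QState q) :
    g.apply (φ + ψ) = g.apply φ + g.apply ψ := by
  cases g <;> ext x <;> simp [Gate.apply, mul_add, Finset.sum_add_distrib]

theorem Layer.normSq_apply {q : ℕ} (U : Layer q) (ψ : QState q) :
    (U.apply ψ).normSq = ψ.normSq := by
  rcases U with ⟨gs, h⟩
  simp only [Layer.apply]
  clear h
  induction gs generalizing ψ with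
  | nil => rfl
  | cons g gs ih => rw [List.foldl_cons, ih, Gate.normSq_apply]

theorem Layer.apply_add {q : ℕ} (U : Layer q) (φ ψ : QState q) :
    U.apply (φ + ψ) = U.apply φ + U.apply ψ := by
  rcases U with ⟨gs, h⟩
  simp only [Layer.apply]
  clear h
  induction gs generalizing φ ψ with
  | nil => rfl
  | cons g gs ih => simp only [List.foldl_cons, Gate.apply_add, ih]

section Oracle

variable {ι : Type} {m k q : ℕ}

/-- The input of a query when the register is in the basis state `y`. -/
def Query.input (Q : Query ι m k q) (y : Bits q) : Bits m := fun l => y (Q.wires (Sum.inl l))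

theorem Query.basisMap_apply (O : Oracle ι m k) (Q : Query ι m k q) (y : Bits q) (w : Fin q) :
    Q.basisMap O y w =
      y w + ∑ j, if Q.wires (Sum.inr j) = w then O Q.index (Q.input y) j else 0 := rfl

theorem Query.basisMap_of_notMem_support (O : Oracle ι m k) (Q : Query ι m k q) (y : Bits q)
    {w : Fin q} (hw : w ∉ Q.support) : Q.basisMap O y w = y w := by
  have : ∀ j, Q.wires (Sum.inr j) ≠ w := by
    intro j hj
    exact hw (by simp [Query.support, ← hj])
  simp [Query.basisMap, this]

theorem Query.basisMap_inl (O : Oracle ι m k) (Q : Query ι m k q) (y : Bits q) (l : Fin m) :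
    Q.basisMap O y (Q.wires (Sum.inl l)) = y (Q.wires (Sum.inl l)) := by
  simp [Query.basisMap]

theorem Query.basisMap_involutive (O : Oracle ι m k) (Q : Query ι m k q) :
    Function.Involutive (Q.basisMap O) := by
  intro y
  ext w
  have h := Query.basisMap_inl O Q y
  rw [Query.basisMap_apply, Query.basisMap_apply, show Q.input (Q.basisMap O y) = Q.input y from
    funext h, add_assoc, CharTwo.add_self_eq_zero, add_zero]

/-- The map on basis states through which a parallel oracle call acts: the amplitude of `y` after the
call is the amplitude of its image before the call. -/
noncomputable def queriesMap (O : Oracle ι m k) (L : List (Query ι m k q)) (y : Bits q) : Bits q :=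
  L.foldr (fun Q y => Q.basisMap O y) y

theorem queriesMap_bijective (O : Oracle ι m k) (L : List (Query ι m k q)) :
    Function.Bijective (queriesMap O L) := by
  induction L with
  | nil => exact Function.bijective_id
  | cons Q L ih => exact (Q.basisMap_involutive O).bijective.comp ih

theorem OracleLayer.apply_eq (O : Oracle ι m k) (L : OracleLayer ι m k q) (ψ : QState q)
    (y : Bits q) : L.apply O ψ y = ψ (queriesMap O L.queries y) := by
  rcases L with ⟨Qs, h⟩
  simp only [OracleLayer.apply]
  clear h
  induction Qs generalizing ψ with
  | nil => rfl
  | cons Q L ih => rw [List.foldl_cons, ih]; rfl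

theorem OracleLayer.normSq_apply (O : Oracle ι m k) (L : OracleLayer ι m k q) (ψ : QState q) :
    (L.apply O ψ).normSq = ψ.normSq := by
  simp only [QState.normSq, OracleLayer.apply_eq]
  exact (queriesMap_bijective O L.queries).sum_comp fun x => ‖ψ x‖ ^ 2

theorem OracleLayer.apply_add (O : Oracle ι m k) (L : OracleLayer ι m k q) (φ ψ : QState q) :
    L.apply O (φ + ψ) = L.apply O φ + L.apply O ψ := by
  ext y
  simp [OracleLayer.apply_eq]

/-- Queries on disjoint qubits leave the inputs of each other unchanged. -/
theorem Query.input_queriesMap (O : Oracle ι m k) {L : List (Query ι m k q)}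
    (hL : L.Pairwise fun Q R => Disjoint Q.support R.support) {Q : Query ι m k q}
    (hQ : Q ∈ L ∨ ∀ R ∈ L, Disjoint Q.support R.support) (y : Bits q) :
    Q.input (queriesMap O L y) = Q.input y := by
  induction L with
  | nil => rfl
  | cons R L ih =>
    rw [List.pairwise_cons] at hL
    have hout : (∀ S ∈ R :: L, Disjoint Q.support S.support) →
        Q.input (queriesMap O (R :: L) y) = Q.input y := by
      intro h
      rw [← ih hL.2 (Or.inr fun S hS => h S (List.mem_cons_of_mem _ hS))]
      ext l
      refine Query.basisMap_of_notMem_support O R _ fun hw => ?_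
      exact Finset.disjoint_left.mp (h R List.mem_cons_self) (by simp [Query.support]) hw
    rcases hQ with hQ | hQ
    · rcases List.mem_cons.mp hQ with rfl | hQ
      · rw [← ih hL.2 (Or.inr hL.1)]
        ext l
        exact Query.basisMap_inl O Q _ l
      · rw [← ih hL.2 (Or.inl hQ)]
        ext l
        refine Query.basisMap_of_notMem_support O R _ fun hw => ?_
        exact Finset.disjoint_left.mp (hL.1 Q hQ) hw (by simp [Query.support])
    · exact hout hQ

theorem queriesMap_congr {O O' : Oracle ι m k} {L : List (Query ι m k q)}
    (hL : L.Pairwise fun Q R => Disjoint Q.support R.support) {y : Bits q}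
    (h : ∀ Q ∈ L, O Q.index (Q.input y) = O' Q.index (Q.input y)) :
    queriesMap O L y = queriesMap O' L y := by
  induction L with
  | nil => rfl
  | cons R L ih =>
    rw [List.pairwise_cons] at hL
    have h1 := ih hL.2 fun Q hQ => h Q (List.mem_cons_of_mem _ hQ)
    have h2 : R.input (queriesMap O' L y) = R.input y :=
      Query.input_queriesMap O' hL.2 (Or.inr hL.1) y
    change R.basisMap O (queriesMap O L y) = R.basisMap O' (queriesMap O' L y)
    rw [h1]
    ext w
    rw [Query.basisMap_apply, Query.basisMap_apply, h2, h R List.mem_cons_self]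

/-- Two oracles act on a state in the same way up to the weight of the basis states on which some
query has an input where the oracles differ. -/
theorem OracleLayer.normSq_sub_le (O O' : Oracle ι m k) (L : OracleLayer ι m k q) (ψ : QState q) :
    (L.apply O ψ - L.apply O' ψ).normSq ≤
      4 * ∑ y, ({y : Bits q | ∃ Q ∈ L.queries,
        O Q.index (Q.input y) ≠ O' Q.index (Q.input y)}.indicator (fun y => ‖ψ y‖ ^ 2) y) := by
  -- The set of these basis states is invariant under both oracle calls.
  set S : Set (Bits q) := {y | ∃ Q ∈ L.queries, O Q.index (Q.input y) ≠ O' Q.index (Q.input y)}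
    with hS
  have inv : ∀ (O₁ : Oracle ι m k) (y : Bits q), queriesMap O₁ L.queries y ∈ S ↔ y ∈ S := by
    intro O₁ y
    simp only [hS, Set.mem_ofPred_eq]
    refine exists_congr fun Q => and_congr_right fun hQ => ?_
    rw [Query.input_queriesMap O₁ L.disjoint (Or.inl hQ)]
  have wt : ∀ O₁ : Oracle ι m k, ∑ y, S.indicator (fun y => ‖L.apply O₁ ψ y‖ ^ 2) y =
      ∑ y, S.indicator (fun y => ‖ψ y‖ ^ 2) y := by
    intro O₁
    rw [← (queriesMap_bijective O₁ L.queries).sum_comp (S.indicator fun y => ‖ψ y‖ ^ 2)]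
    refine Finset.sum_congr rfl fun y _ => ?_
    classical
    simp [Set.indicator_apply, inv, OracleLayer.apply_eq]
  have hpt : ∀ y, ‖(L.apply O ψ - L.apply O' ψ) y‖ ^ 2 ≤
      2 * S.indicator (fun y => ‖L.apply O ψ y‖ ^ 2) y +
        2 * S.indicator (fun y => ‖L.apply O' ψ y‖ ^ 2) y := by
    intro y
    by_cases hy : y ∈ S
    · have := norm_add_sq_le_weighted (L.apply O ψ y) (-L.apply O' ψ y) one_pos
      rw [norm_neg, ← sub_eq_add_neg] at this
      norm_num at this
      simpa [hy] using this
    · have : L.apply O ψ y = L.apply O' ψ y := by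
        rw [OracleLayer.apply_eq, OracleLayer.apply_eq, queriesMap_congr L.disjoint]
        intro Q hQ
        by_contra hne
        exact hy ⟨Q, hQ, hne⟩
      simp [this, hy]
  calc _ ≤ ∑ y, _ := Finset.sum_le_sum fun y _ => hpt y
    _ = _ := by
      rw [Finset.sum_add_distrib, ← Finset.mul_sum, ← Finset.mul_sum, wt, wt]
      ring

/-- Disjointness bounds the number of parallel queries by the number of qubits. -/
theorem OracleLayer.length_queries_le (hk : 0 < k) (L : OracleLayer ι m k q) :
    L.queries.length ≤ q := by
  have hnd : (L.queries.map fun Q => Q.wires (Sum.inr ⟨0, hk⟩)).Nodup := by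
    refine List.Pairwise.map _ (fun Q R hQR heq => ?_) L.disjoint
    refine Finset.disjoint_left.mp hQR
      (Finset.mem_map_of_mem Q.wires (Finset.mem_univ (Sum.inr ⟨0, hk⟩))) ?_
    rw [heq]
    exact Finset.mem_map_of_mem R.wires (Finset.mem_univ _)
  simpa using hnd.length_le_card

end Oracle

/-! ### The output probability as a quadratic form -/

section RunProb

variable {ι : Type} {m k q b n : ℕ}

/-- The unnormalised state after a measurement that leaves the classical bits `c'`, if they were `c`
before. -/
noncomputable def QCRound.collapse (r : QCRound ι m k q b) (c c' : Bits b) (φ : QState q) :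
    QState q :=
  fun x => if r.record c x = c' then φ x else 0

theorem QCRound.collapse_add (r : QCRound ι m k q b) (c c' : Bits b) (φ ψ : QState q) :
    r.collapse c c' (φ + ψ) = r.collapse c c' φ + r.collapse c c' ψ := by
  ext x
  by_cases h : r.record c x = c' <;> simp [QCRound.collapse, h]

theorem QCRound.sum_normSq_collapse (r : QCRound ι m k q b) (c : Bits b) (φ : QState q) :
    ∑ c', (r.collapse c c' φ).normSq = φ.normSq := by
  simp only [QState.normSq, QCRound.collapse]
  rw [Finset.sum_comm]
  refine Finset.sum_congr rfl fun x _ => ?_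
  rw [Finset.sum_eq_single (r.record c x)] <;> simp +contextual [eq_comm]

variable (O : Oracle ι m k) (final : ClassicalCircuit ι m k b) (output : Fin n → Fin b)
  (t : Bits n)

theorem runProb_cons (r : QCRound ι m k q b) (rs : List (QCRound ι m k q b)) (c : Bits b)
    (ψ : QState q) :
    runProb O final output t (r :: rs) c ψ =
      ∑ c', runProb O final output t rs c' (r.collapse (r.classical.run O c) c'
        (r.oracleCall.apply O ((r.unitary (r.classical.run O c)).apply ψ))) := rfl

theorem runProb_nonneg (rs : List (QCRound ι m k q b)) (c : Bits b) (ψ : QState q) :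
    0 ≤ runProb O final output t rs c ψ := by
  induction rs generalizing c ψ with
  | nil =>
    simp only [runProb]
    split_ifs
    · exact QState.normSq_nonneg ψ
    · exact le_rfl
  | cons r rs ih => exact Finset.sum_nonneg fun c' _ => ih _ _

theorem runProb_le_normSq (rs : List (QCRound ι m k q b)) (c : Bits b) (ψ : QState q) :
    runProb O final output t rs c ψ ≤ ψ.normSq := by
  induction rs generalizing c ψ with
  | nil =>
    simp only [runProb]
    split_ifs
    · exact le_rfl
    · exact QState.normSq_nonneg ψ
  | cons r rs ih =>
    rw [runProb_cons]
    refine (Finset.sum_le_sum fun c' _ => ih _ _).trans ?_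
    rw [QCRound.sum_normSq_collapse, OracleLayer.normSq_apply, Layer.normSq_apply]

/-- The inequality `‖a + b‖² ≤ (1 + l) ‖a‖² + (1 + l⁻¹) ‖b‖²` holds for the output probability, which
is a sum of squared norms of linear functions of the state. -/
theorem runProb_add_le_weighted (rs : List (QCRound ι m k q b)) (c : Bits b) (φ ψ : QState q)
    {l : ℝ} (hl : 0 < l) :
    runProb O final output t rs c (φ + ψ) ≤
      (1 + l) * runProb O final output t rs c φ + (1 + l⁻¹) * runProb O final output t rs c ψ := by
  induction rs generalizing c φ ψ with
  | nil =>
    simp only [runProb]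
    split_ifs
    · exact QState.normSq_add_le_weighted φ ψ hl
    · simp
  | cons r rs ih =>
    simp only [runProb_cons, Finset.mul_sum, ← Finset.sum_add_distrib]
    refine Finset.sum_le_sum fun c' _ => ?_
    rw [Layer.apply_add, OracleLayer.apply_add, QCRound.collapse_add]
    exact ih _ _ _

end RunProb

/-! ### Resampling a Simon function away from the queried points -/

theorem Bits.add_self {n : ℕ} (x : Bits n) : x + x = 0 :=
  funext fun i => CharTwo.add_self_eq_zero (x i)

theorem Bits.add_add_cancel {n : ℕ} (x y : Bits n) : x + y + y = x := by
  rw [add_assoc, Bits.add_self, add_zero]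

/-- Two nonzero bit strings are separated from zero by a common linear functional. -/
theorem exists_addMonoidHom_eq_one {n : ℕ} {a b : Bits n} (ha : a ≠ 0) (hb : b ≠ 0) :
    ∃ l : Bits n →+ ZMod 2, l a = 1 ∧ l b = 1 := by
  have two : ∀ z : ZMod 2, z ≠ 0 → z = 1 := by decide
  have two' : ∀ z : ZMod 2, z ≠ 1 → z = 0 := by decide
  obtain ⟨i, hi⟩ := Function.ne_iff.mp ha
  obtain ⟨j, hj⟩ := Function.ne_iff.mp hb
  have hi' := two _ hi
  have hj' := two _ hj
  by_cases hbi : b i = 1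
  · exact ⟨Pi.evalAddMonoidHom _ i, hi', hbi⟩
  by_cases haj : a j = 1
  · exact ⟨Pi.evalAddMonoidHom _ j, haj, hj'⟩
  · exact ⟨Pi.evalAddMonoidHom (fun _ : Fin n => ZMod 2) i + Pi.evalAddMonoidHom _ j,
      by rw [AddMonoidHom.add_apply]; change a i + a j = 1; rw [hi', two' _ haj, add_zero],
      by rw [AddMonoidHom.add_apply]; change b i + b j = 1; rw [hj', two' _ hbi, zero_add]⟩

/-- If no two elements of `D` differ by `a` or by `b`, then `D` extends to a set that contains
exactly one element of each pair `{y, y + a}` and of each pair `{y, y + b}`. -/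
theorem exists_common_transversal {n : ℕ} (D : Finset (Bits n)) {a b : Bits n} (ha : a ≠ 0)
    (hb : b ≠ 0) (haD : a ∉ D + D) (hbD : b ∉ D + D) :
    ∃ E : Set (Bits n), (∀ x ∈ D, x ∈ E) ∧ (∀ y, y + a ∈ E ↔ y ∉ E) ∧ (∀ y, y + b ∈ E ↔ y ∉ E) := by
  obtain ⟨l, hla, hlb⟩ := exists_addMonoidHom_eq_one ha hb
  have two : ∀ z : ZMod 2, z + 1 = 0 ↔ ¬ z = 0 := by decide
  have na : ∀ y, y ∈ D → y + a ∉ D := fun y hy hya =>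
    haD (Finset.mem_add.mpr ⟨y, hy, y + a, hya, by rw [← add_assoc, Bits.add_self, zero_add]⟩)
  have nb : ∀ y, y ∈ D → y + b ∉ D := fun y hy hyb =>
    hbD (Finset.mem_add.mpr ⟨y, hy, y + b, hyb, by rw [← add_assoc, Bits.add_self, zero_add]⟩)
  -- On the cosets of `{0, a, b, a + b}` that meet `D`, the set is `D ∪ (D + a + b)`;
  -- on the others, it is the kernel of the functional `l`.
  obtain ⟨E, hE⟩ : ∃ E : Set (Bits n), ∀ y, y ∈ E ↔
      (y ∈ D ∨ y + a + b ∈ D) ∨ (¬ (y + a ∈ D ∨ y + b ∈ D) ∧ l y = 0) := ⟨{y | _}, fun _ => Iff.rfl⟩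
  refine ⟨E, fun x hx => (hE x).mpr (Or.inl (Or.inl hx)), fun y => ?_, fun y => ?_⟩
  · have e1 : y + a + a = y := Bits.add_add_cancel y a
    have h1 := na y
    have h2 := nb y
    have h3 := na (y + b)
    have h4 := nb (y + a)
    have e2 : y + b + a = y + a + b := by abel
    rw [e2] at h3
    have hl : l (y + a) = 0 ↔ ¬ l y = 0 := by rw [map_add, hla, two]
    rw [hE, hE, e1, hl]
    clear na nb haD hbD hE hl e1 e2
    generalize (y ∈ D) = p₀, (y + a ∈ D) = p₁, (y + b ∈ D) = p₂, (y + a + b ∈ D) = p₃,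
      (l y = 0) = p₄ at h1 h2 h3 h4 ⊢
    tauto
  · have e1 : y + b + b = y := Bits.add_add_cancel y b
    have h1 := na y
    have h2 := nb y
    have h3 := na (y + b)
    have h4 := nb (y + a)
    have e2 : y + b + a = y + a + b := by abel
    have e3 : y + a + b + b = y + a := Bits.add_add_cancel _ b
    rw [e2] at h3
    have hl : l (y + b) = 0 ↔ ¬ l y = 0 := by rw [map_add, hlb, two]
    rw [hE, hE, e1, e2, e3, hl]
    clear na nb haD hbD hE hl e1 e2 e3
    generalize (y ∈ D) = p₀, (y + a ∈ D) = p₁, (y + b ∈ D) = p₂, (y + a + b ∈ D) = p₃,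
      (l y = 0) = p₄ at h1 h2 h3 h4 ⊢
    tauto

/-- If no two elements of `D` differ by `a` or by `b`, then there is a permutation that fixes `D` and
carries the pairs `{x, x + b}` to the pairs `{y, y + a}`. -/
theorem exists_perm_fixing {n : ℕ} (D : Finset (Bits n)) {a b : Bits n} (ha : a ≠ 0)
    (hb : b ≠ 0) (haD : a ∉ D + D) (hbD : b ∉ D + D) :
    ∃ σ : Equiv.Perm (Bits n), (∀ x ∈ D, σ x = x) ∧ ∀ x, σ (x + b) = σ x + a := by
  classical
  obtain ⟨E, hDE, hEa, hEb⟩ := exists_common_transversal D ha hb haD hbD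
  have hEab : ∀ y, y + a + b ∈ E ↔ y ∈ E := fun y => by rw [hEb, hEa, not_not]
  let σ : Bits n → Bits n := fun y => if y ∈ E then y else y + a + b
  have hσ : Function.Involutive σ := by
    intro y
    by_cases hy : y ∈ E
    · simp [σ, hy]
    · simp only [σ, hy, hEab, if_false]
      rw [show y + a + b + a + b = y + a + a + b + b by abel, Bits.add_add_cancel,
        Bits.add_add_cancel]
  refine ⟨hσ.toPerm, fun x hx => if_pos (hDE x hx), fun x => ?_⟩
  change σ (x + b) = σ x + a
  by_cases hx : x ∈ E
  · have : x + b ∉ E := fun h => (hEb x).mp h hx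
    simp only [σ, hx, this, if_true, if_false]
    rw [show x + b + a + b = x + a + b + b by abel, Bits.add_add_cancel]
  · have : x + b ∈ E := (hEb x).mpr hx
    simp only [σ, hx, this, if_true, if_false]
    rw [show x + a + b + a = x + b + a + a by abel, Bits.add_add_cancel]

/-- Precomposition with such a permutation turns a Simon function with period `a` into one with
period `b`. -/
theorem IsSimon.comp_perm {n : ℕ} {f : Bits n → Bits n} {a b : Bits n} (hf : IsSimon f a)
    (hb : b ≠ 0) {σ : Equiv.Perm (Bits n)} (hσ : ∀ x, σ (x + b) = σ x + a) :
    IsSimon (f ∘ σ) b := by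
  refine ⟨hb, fun x y => ?_⟩
  simp only [Function.comp]
  rw [hf.2, ← hσ, σ.injective.eq_iff, σ.injective.eq_iff]

/-- **Resampling.** Let `g ω s` be a nonnegative score of the guess `s` for the period of the `k`-th
Simon function. If `g` and the finite set `D` depend on this function only through its values on `D`,
and the values of this function on `D` do not reveal its period by a collision, then the period is
uniform among the bit strings that `D` does not exclude. -/
theorem sum_score_le {d n T : ℕ} (k : Fin (d + 1)) (D : SerialSample d n → Finset (Bits n))
    (g : SerialSample d n → Bits n → ℝ) (W : SerialSample d n → ℝ)
    (hcard : ∀ ω, (D ω).card ≤ T) (hg : ∀ ω s, 0 ≤ g ω s) (hW : ∀ ω, ∑ s, g ω s ≤ W ω)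
    (hDinv : ∀ ω (p : SimonSample n), (∀ x ∈ D ω, p.fn x = (ω k).fn x) →
      D (Function.update ω k p) = D ω)
    (hginv : ∀ ω (p : SimonSample n), (∀ x ∈ D ω, p.fn x = (ω k).fn x) →
      g (Function.update ω k p) = g ω) :
    ((2 : ℝ) ^ n - 1 - (T : ℝ) ^ 2) *
      ∑ ω, (if (ω k).period ∈ D ω + D ω then 0 else g ω (ω k).period) ≤ ∑ ω, W ω := by
  classical
  -- The periods that are compatible with the absence of a collision on `D ω`.
  let free : SerialSample d n → Finset (Bits n) := fun ω =>
    Finset.univ.filter fun s => s ≠ 0 ∧ s ∉ D ω + D ω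
  have hfree : ∀ ω, (2 : ℝ) ^ n - 1 - (T : ℝ) ^ 2 ≤ (free ω).card := by
    intro ω
    have h1 : (Finset.univ : Finset (Bits n)).card ≤
        (free ω).card + (insert 0 (D ω + D ω)).card := by
      refine (Finset.card_le_card fun s _ => ?_).trans (Finset.card_union_le _ _)
      simp only [free, Finset.mem_union, Finset.mem_filter, Finset.mem_univ, Finset.mem_insert]
      tauto
    have h2 : (insert 0 (D ω + D ω)).card ≤ T ^ 2 + 1 := by
      refine (Finset.card_insert_le _ _).trans ?_
      have := (Finset.card_add_le (s := D ω) (t := D ω)).trans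
        (Nat.mul_le_mul (hcard ω) (hcard ω))
      rw [sq]
      omega
    have h3 : (Finset.univ : Finset (Bits n)).card = 2 ^ n := by simp [ZMod.card]
    have h4 : (2 ^ n : ℕ) ≤ (free ω).card + (T ^ 2 + 1) := by omega
    have h5 : ((2 ^ n : ℕ) : ℝ) ≤ ((free ω).card + (T ^ 2 + 1) : ℕ) := by exact_mod_cast h4
    push_cast at h5
    linarith
  let V : Finset (SerialSample d n × Bits n) :=
    Finset.univ.filter fun p => (p.1 k).period ∉ D p.1 + D p.1 ∧ p.2 ∈ free p.1
  -- The permutation is a function of the set `D` and of the two periods alone: this makes the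
  -- exchange of the period with the guess injective.
  let good : Finset (Bits n) → Bits n → Bits n → Equiv.Perm (Bits n) → Prop := fun D a b σ =>
    (∀ x ∈ D, σ x = x) ∧ ∀ x, σ (x + b) = σ x + a
  let σ : Finset (Bits n) → Bits n → Bits n → Equiv.Perm (Bits n) := fun D a b =>
    Classical.epsilon (good D a b)
  let new : SerialSample d n × Bits n → SimonSample n := fun p =>
    if h : IsSimon ((p.1 k).fn ∘ σ (D p.1) (p.1 k).period p.2) p.2 then ⟨_, _, h⟩ else p.1 k
  let Φ : SerialSample d n × Bits n → SerialSample d n × Bits n := fun p =>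
    (Function.update p.1 k (new p), (p.1 k).period)
  have hσ : ∀ p ∈ V, good (D p.1) (p.1 k).period p.2 (σ (D p.1) (p.1 k).period p.2) := by
    intro p hp
    simp only [V, free, Finset.mem_filter, Finset.mem_univ, true_and] at hp
    exact Classical.epsilon_spec
      (exists_perm_fixing _ (p.1 k).isSimon.1 hp.2.1 hp.1 hp.2.2)
  have hnew : ∀ p ∈ V, (new p).fn = (p.1 k).fn ∘ σ (D p.1) (p.1 k).period p.2 ∧
      (new p).period = p.2 := by
    intro p hp
    have h0 : p.2 ≠ 0 := by
      simp only [V, free, Finset.mem_filter, Finset.mem_univ, true_and] at hp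
      exact hp.2.1
    have h := (p.1 k).isSimon.comp_perm h0 (hσ p hp).2
    simp [new, dif_pos h]
  have hagree : ∀ p ∈ V, ∀ x ∈ D p.1, (new p).fn x = (p.1 k).fn x := by
    intro p hp x hx
    rw [(hnew p hp).1, Function.comp, (hσ p hp).1 x hx]
  have hinj : Set.InjOn Φ V := by
    intro p hp q hq hpq
    have h1 : Function.update p.1 k (new p) = Function.update q.1 k (new q) :=
      congrArg Prod.fst hpq
    have h2 : (p.1 k).period = (q.1 k).period := congrArg Prod.snd hpq
    have h3 : new p = new q := by simpa using congrFun h1 k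
    have h4 : p.2 = q.2 := by rw [← (hnew p hp).2, ← (hnew q hq).2, h3]
    have h5 : D p.1 = D q.1 := by
      rw [← hDinv p.1 _ (hagree p hp), ← hDinv q.1 _ (hagree q hq), h1]
    have h6 : (p.1 k).fn = (q.1 k).fn := by
      have h := (hnew p hp).1
      rw [h3, (hnew q hq).1, h2, h4, h5] at h
      exact ((Equiv.surjective _).injective_comp_right h).symm
    refine Prod.ext (funext fun i => ?_) h4
    by_cases hi : i = k
    · subst hi
      exact SimonSample.injective_pair n (Prod.ext h6 h2)
    · simpa [hi] using congrFun h1 i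
  calc ((2 : ℝ) ^ n - 1 - (T : ℝ) ^ 2) *
        ∑ ω, (if (ω k).period ∈ D ω + D ω then 0 else g ω (ω k).period)
      ≤ ∑ ω, ∑ s ∈ free ω, (if (ω k).period ∈ D ω + D ω then 0 else g ω (ω k).period) := by
        rw [Finset.mul_sum]
        refine Finset.sum_le_sum fun ω _ => ?_
        rw [Finset.sum_const, nsmul_eq_mul]
        refine mul_le_mul_of_nonneg_right (hfree ω) ?_
        split_ifs
        · exact le_rfl
        · exact hg _ _
    _ = ∑ p ∈ V, g p.1 (p.1 k).period := by
        simp only [V, Finset.sum_filter, Fintype.sum_prod_type]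
        refine Finset.sum_congr rfl fun ω _ => ?_
        rw [← Finset.sum_subset (Finset.subset_univ (free ω)) fun s _ hs => if_neg fun h => hs h.2]
        refine Finset.sum_congr rfl fun s hs => ?_
        by_cases h : (ω k).period ∈ D ω + D ω <;> simp [h, hs]
    _ = ∑ p ∈ V, g (Φ p).1 (Φ p).2 := by
        refine Finset.sum_congr rfl fun p hp => ?_
        rw [hginv p.1 (new p) (hagree p hp)]
    _ = ∑ p ∈ V.image Φ, g p.1 p.2 := 
        (Finset.sum_image (f := fun p : SerialSample d n × Bits n => g p.1 p.2) hinj).symm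
    _ ≤ ∑ p : SerialSample d n × Bits n, g p.1 p.2 :=
        Finset.sum_le_sum_of_subset_of_nonneg (Finset.subset_univ _) fun p _ _ => hg _ _
    _ ≤ ∑ ω, W ω := by
        rw [Fintype.sum_prod_type]
        exact Finset.sum_le_sum fun ω _ => hW ω

/-! ### Queries of classical circuits -/

/-- The list of the oracle queries, each a sub-oracle with an input, that a classical circuit makes
when it is run from the bits `c`. -/
noncomputable def ClassicalCircuit.queries {ι : Type} {m k b : ℕ} (O : Oracle ι m k) :
    ClassicalCircuit ι m k b → Bits b → List (ι × Bits m)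
  | [], _ => []
  | .nand a₁ a₂ t :: A, c =>
      ClassicalCircuit.queries O A ((ClassicalGate.nand a₁ a₂ t : ClassicalGate ι m k b).run O c)
  | .query i inp out :: A, c =>
      (i, fun j => c (inp j)) ::
        ClassicalCircuit.queries O A ((ClassicalGate.query i inp out).run O c)

section Queries

variable {ι : Type} {m k b : ℕ}

theorem ClassicalCircuit.length_queries_le (O : Oracle ι m k) (A : ClassicalCircuit ι m k b)
    (c : Bits b) : (A.queries O c).length ≤ A.length := by
  induction A generalizing c with
  | nil => simp [ClassicalCircuit.queries]
  | cons g A ih =>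
    cases g with
    | nand a₁ a₂ t => exact (ih _).trans (Nat.le_succ _)
    | query i inp out => exact Nat.succ_le_succ (ih _)

theorem ClassicalCircuit.run_cons (O : Oracle ι m k) (g : ClassicalGate ι m k b)
    (A : ClassicalCircuit ι m k b) (c : Bits b) :
    ClassicalCircuit.run O (g :: A) c = A.run O (g.run O c) := rfl

theorem ClassicalCircuit.queries_append (O : Oracle ι m k) (A A' : ClassicalCircuit ι m k b)
    (c : Bits b) :
    ClassicalCircuit.queries O (A ++ A') c = A.queries O c ++ A'.queries O (A.run O c) := by
  induction A generalizing c with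
  | nil => rfl
  | cons g A ih =>
    cases g with
    | nand a₁ a₂ t => exact ih _
    | query i inp out => exact congrArg (List.cons _) (ih _)

theorem ClassicalCircuit.queries_singleton (O O' : Oracle ι m k) (g : ClassicalGate ι m k b)
    (c : Bits b) : ClassicalCircuit.queries O [g] c = ClassicalCircuit.queries O' [g] c := by
  cases g <;> rfl

/-- A classical circuit cannot tell apart two oracles that agree on the queries it makes. -/
theorem ClassicalCircuit.run_congr {O O' : Oracle ι m k} {A : ClassicalCircuit ι m k b} {c : Bits b}
    (h : ∀ p ∈ A.queries O c, O' p.1 p.2 = O p.1 p.2) :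
    A.queries O' c = A.queries O c ∧ A.run O' c = A.run O c := by
  induction A generalizing c with
  | nil => exact ⟨rfl, rfl⟩
  | cons g A ih =>
    rw [ClassicalCircuit.run_cons, ClassicalCircuit.run_cons]
    cases g with
    | nand a₁ a₂ t => exact ih h
    | query i inp out =>
      have h1 : O' i (fun j => c (inp j)) = O i fun j => c (inp j) := h _ List.mem_cons_self
      have h2 : (ClassicalGate.query i inp out).run O' c = (ClassicalGate.query i inp out).run O c := by
        simp only [ClassicalGate.run, h1]
      have h3 := ih (c := (ClassicalGate.query i inp out).run O c)
        fun p hp => h p (List.mem_cons_of_mem _ hp)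
      rw [h2]
      refine ⟨?_, h3.2⟩
      change _ :: _ = _ :: _
      rw [h2, h3.1]

end Queries

/-! ### The truncated serial oracle -/

section Truncation

variable {d n : ℕ}

/-- The first argument `x` of a query `(x, z)` to the serial oracle. -/
def fstArg (w : Bits (n + n)) : Bits n := fun j => w (Fin.castAdd n j)

/-- The second argument `z` of a query `(x, z)` to the serial oracle. -/
def sndArg (w : Bits (n + n)) : Bits n := fun j => w (Fin.natAdd n j)

/-- The serial oracle in which the sub-oracles after the `j`-th one always answer `⊥`. -/
noncomputable def truncOracle (j : ℕ) (ω : SerialSample d n) :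
    Oracle (Fin (d + 1)) (n + n) (n + 1) :=
  fun i w => if (i : ℕ) ≤ j then serialOracle ω i w else 0

/-- The points at which the `k`-th Simon function is queried. -/
def queryPoints (k : Fin (d + 1)) (L : List (Fin (d + 1) × Bits (n + n))) : Finset (Bits n) :=
  ((L.filter fun p => p.1 = k).map fun p => fstArg p.2).toFinset

/-- The bit strings that are tried as the period of the `k`-th Simon function, to unlock the next
sub-oracle. -/
def queryKeys (k : Fin (d + 1)) (L : List (Fin (d + 1) × Bits (n + n))) : Finset (Bits n) :=
  ((L.filter fun p => (p.1 : ℕ) = k + 1).map fun p => sndArg p.2).toFinset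

theorem card_queryPoints_le (k : Fin (d + 1)) (L : List (Fin (d + 1) × Bits (n + n))) :
    (queryPoints k L).card ≤ L.length :=
  (List.toFinset_card_le _).trans (by simpa using List.length_filter_le _ _)

theorem card_queryKeys_le (k : Fin (d + 1)) (L : List (Fin (d + 1) × Bits (n + n))) :
    (queryKeys k L).card ≤ L.length :=
  (List.toFinset_card_le _).trans (by simpa using List.length_filter_le _ _)

theorem queryPoints_append (k : Fin (d + 1)) (L L' : List (Fin (d + 1) × Bits (n + n))) :
    queryPoints k (L ++ L') = queryPoints k L ∪ queryPoints k L' := by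
  simp [queryPoints]

theorem fstArg_mem_queryPoints {L : List (Fin (d + 1) × Bits (n + n))}
    {p : Fin (d + 1) × Bits (n + n)} (hp : p ∈ L) : fstArg p.2 ∈ queryPoints p.1 L := by
  simp only [queryPoints, List.mem_toFinset, List.mem_map, List.mem_filter]
  exact ⟨p, ⟨hp, by simp⟩, rfl⟩

theorem serialOracle_eq_truncOracle (ω : SerialSample d n) : serialOracle ω = truncOracle d ω := by
  funext i w
  simp [truncOracle, Nat.lt_succ_iff.mp i.2]

/-- A query that tells the serial oracle from its truncation contains a period that the truncation
does not depend on. -/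
theorem exists_period_mem_queryKeys {j : ℕ} {ω : SerialSample d n}
    {L : List (Fin (d + 1) × Bits (n + n))} {p : Fin (d + 1) × Bits (n + n)} (hp : p ∈ L)
    (h : serialOracle ω p.1 p.2 ≠ truncOracle j ω p.1 p.2) :
    ∃ k : Fin (d + 1), j ≤ k ∧ (ω k).period ∈ queryKeys k L := by
  rcases p with ⟨i, w⟩
  simp only [truncOracle] at h
  split_ifs at h with hij
  · exact absurd rfl h
  · cases i using Fin.cases with
    | zero => simp at hij
    | succ l =>
      have hz : sndArg w = (ω l.castSucc).period := by
        by_contra hz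
        refine h ?_
        change encode (if sndArg w = (ω l.castSucc).period then _ else none) = 0
        rw [if_neg hz]
        rfl
      refine ⟨l.castSucc, by simp at hij; simp; omega, ?_⟩
      simp only [queryKeys, List.mem_toFinset, List.mem_map, List.mem_filter]
      exact ⟨_, ⟨hp, by simp⟩, hz⟩

theorem truncOracle_update {j : ℕ} {k : Fin (d + 1)} (hjk : j ≤ k) (ω : SerialSample d n)
    (p : SimonSample n) (i : Fin (d + 1)) (w : Bits (n + n))
    (h : i = k → p.fn (fstArg w) = (ω k).fn (fstArg w)) :
    truncOracle j (Function.update ω k p) i w = truncOracle j ω i w := by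
  simp only [truncOracle]
  split_ifs with hij
  · have hfn : (Function.update ω k p i).fn (fstArg w) = (ω i).fn (fstArg w) := by
      by_cases hik : i = k
      · subst hik
        simpa using h rfl
      · rw [Function.update_of_ne hik]
    cases i using Fin.cases with
    | zero => exact congrArg (fun y => encode (some y)) hfn
    | succ l =>
      have hl : l.castSucc ≠ k := by
        rintro rfl
        simp at hij hjk
        omega
      change encode (if sndArg w = (Function.update ω k p l.castSucc).period then
          some ((Function.update ω k p l.succ).fn (fstArg w)) else none) =
        encode (if sndArg w = (ω l.castSucc).period then some ((ω l.succ).fn (fstArg w)) else none)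
      rw [Function.update_of_ne hl, hfn]
  · rfl

/-- A quantity does not depend on the Simon functions from the `j`-th one on. -/
def DependsBelow {X : Type*} (j : ℕ) (h : SerialSample d n → X) : Prop :=
  ∀ (ω : SerialSample d n) (k : Fin (d + 1)) (p : SimonSample n), j ≤ k →
    h (Function.update ω k p) = h ω

theorem truncOracle_dependsBelow (j : ℕ) :
    DependsBelow (d := d) (n := n) (j + 1) (truncOracle j) := by
  intro ω k p hk
  by_cases h : ∃ i : Fin (d + 1), (i : ℕ) ≤ j ∧ i = k
  · obtain ⟨i, hi, rfl⟩ := h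
    omega
  · funext i w
    by_cases hij : (i : ℕ) ≤ j
    · exact truncOracle_update (by omega) ω p i w fun hik => absurd ⟨i, hij, hik⟩ h
    · simp [truncOracle, hij]

variable {b : ℕ} {j : ℕ} (A : ClassicalCircuit (Fin (d + 1)) (n + n) (n + 1) b)
  {c : SerialSample d n → Bits b}

/-- A classical circuit with access to the truncated oracle learns nothing about the `k`-th Simon
function besides its values at the points it queries. -/
theorem run_truncOracle_update (hc : DependsBelow j c) {k : Fin (d + 1)} (hjk : j ≤ k)
    (ω : SerialSample d n) (p : SimonSample n)
    (h : ∀ x ∈ queryPoints k (A.queries (truncOracle j ω) (c ω)), p.fn x = (ω k).fn x) :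
    A.queries (truncOracle j (Function.update ω k p)) (c (Function.update ω k p)) =
        A.queries (truncOracle j ω) (c ω) ∧
      A.run (truncOracle j (Function.update ω k p)) (c (Function.update ω k p)) =
        A.run (truncOracle j ω) (c ω) := by
  rw [hc ω k p hjk]
  refine ClassicalCircuit.run_congr fun r hr => truncOracle_update hjk ω p r.1 r.2 ?_
  intro hrk
  refine h _ ?_
  rw [← hrk]
  exact fstArg_mem_queryPoints hr

/-- `sum_score_le` for the points queried by a classical circuit with access to the truncated
oracle. -/
theorem sum_score_queries_le {T : ℕ} (hA : A.length ≤ T) (hc : DependsBelow j c) {k : Fin (d + 1)}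
    (hjk : j ≤ k) (g : SerialSample d n → Bits n → ℝ) (W : SerialSample d n → ℝ)
    (hg : ∀ ω s, 0 ≤ g ω s) (hW : ∀ ω, ∑ s, g ω s ≤ W ω)
    (hginv : ∀ ω (p : SimonSample n),
      A.queries (truncOracle j (Function.update ω k p)) (c (Function.update ω k p)) =
        A.queries (truncOracle j ω) (c ω) →
      A.run (truncOracle j (Function.update ω k p)) (c (Function.update ω k p)) =
        A.run (truncOracle j ω) (c ω) → g (Function.update ω k p) = g ω) :
    ((2 : ℝ) ^ n - 1 - (T : ℝ) ^ 2) *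
      ∑ ω, (if (ω k).period ∈ queryPoints k (A.queries (truncOracle j ω) (c ω)) +
          queryPoints k (A.queries (truncOracle j ω) (c ω)) then 0 else g ω (ω k).period) ≤
      ∑ ω, W ω := by
  refine sum_score_le k (fun ω => queryPoints k (A.queries (truncOracle j ω) (c ω))) g W
    (fun ω => ?_) hg hW (fun ω p h => ?_) (fun ω p h => ?_)
  · exact (card_queryPoints_le _ _).trans ((A.length_queries_le _ _).trans hA)
  · exact congrArg _ (run_truncOracle_update A hc hjk ω p h).1
  · have := run_truncOracle_update A hc hjk ω p h
    exact hginv ω p this.1 this.2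

theorem sum_ite_mem_const {X : Type*} [Fintype X] [DecidableEq X] (S : Finset X) (v : ℝ) :
    ∑ s, (if s ∈ S then v else 0) = S.card * v := by
  simp

/-- A classical circuit is unlikely to query a collision: for each gate, the next point is one of few
that complete a collision with the points queried before. -/
theorem sum_collision_le {T : ℕ} (hT : 0 ≤ (2 : ℝ) ^ n - 1 - (T : ℝ) ^ 2) (hA : A.length ≤ T)
    (hc : DependsBelow j c) {v : SerialSample d n → ℝ} (hv : DependsBelow j v) (hv0 : ∀ ω, 0 ≤ v ω)
    {k : Fin (d + 1)} (hjk : j ≤ k) :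
    ((2 : ℝ) ^ n - 1 - (T : ℝ) ^ 2) *
      ∑ ω, (if (ω k).period ∈ queryPoints k (A.queries (truncOracle j ω) (c ω)) +
          queryPoints k (A.queries (truncOracle j ω) (c ω)) then v ω else 0) ≤
      (A.length * T : ℝ) * ∑ ω, v ω := by
  induction A using List.reverseRecOn with
  | nil => simp [ClassicalCircuit.queries, queryPoints]
  | append_singleton A g ih =>
    rw [List.length_append, List.length_singleton] at hA
    have ih' := ih (by omega)
    let D : SerialSample d n → Finset (Bits n) := fun ω =>
      queryPoints k (ClassicalCircuit.queries (truncOracle j ω) A (c ω))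
    -- At most one point is added by the last gate, and which one depends on the earlier answers only.
    let N : SerialSample d n → Finset (Bits n) := fun ω =>
      queryPoints k (ClassicalCircuit.queries (truncOracle j ω) [g]
        (ClassicalCircuit.run (truncOracle j ω) A (c ω)))
    have hN : ∀ ω, (N ω).card ≤ 1 := fun ω =>
      (card_queryPoints_le _ _).trans (ClassicalCircuit.length_queries_le _ _ _)
    have hD : ∀ ω, (D ω).card ≤ T := fun ω =>
      (card_queryPoints_le _ _).trans ((ClassicalCircuit.length_queries_le _ A _).trans (by omega))
    have hnew := sum_score_queries_le A (T := T) (by omega) hc hjk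
      (fun ω s => if s ∈ N ω + D ω then v ω else 0) (fun ω => T * v ω)
      (fun ω s => by split_ifs <;> simp [hv0])
      (fun ω => by
        rw [sum_ite_mem_const]
        refine mul_le_mul_of_nonneg_right ?_ (hv0 ω)
        have h := Finset.card_add_le (s := N ω) (t := D ω)
        have h' := Nat.mul_le_mul (hN ω) (hD ω)
        rw [one_mul] at h'
        exact_mod_cast h.trans h')
      (fun ω p h1 h2 => by
        funext s
        simp only [N, D, hv ω k p hjk, h1, h2]
        rw [ClassicalCircuit.queries_singleton _ (truncOracle j ω)])
    rw [← Finset.mul_sum] at hnew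
    have hpt : ∀ ω, (if (ω k).period ∈
          queryPoints k (ClassicalCircuit.queries (truncOracle j ω) (A ++ [g]) (c ω)) +
          queryPoints k (ClassicalCircuit.queries (truncOracle j ω) (A ++ [g]) (c ω))
          then v ω else 0) ≤
        (if (ω k).period ∈ D ω + D ω then v ω else 0) +
        (if (ω k).period ∈ D ω + D ω then 0 else
          if (ω k).period ∈ N ω + D ω then v ω else 0) := by
      intro ω
      rw [ClassicalCircuit.queries_append, queryPoints_append]
      change (if _ ∈ (D ω ∪ N ω) + (D ω ∪ N ω) then v ω else 0) ≤ _
      have h1 : (ω k).period ∈ (D ω ∪ N ω) + (D ω ∪ N ω) →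
          (ω k).period ∈ D ω + D ω ∨ (ω k).period ∈ N ω + D ω := by
        intro h
        obtain ⟨x, hx, y, hy, hxy⟩ := Finset.mem_add.mp h
        rw [← hxy]
        rcases Finset.mem_union.mp hx with hx | hx <;> rcases Finset.mem_union.mp hy with hy | hy
        · exact Or.inl (Finset.add_mem_add hx hy)
        · exact Or.inr (add_comm x y ▸ Finset.add_mem_add hy hx)
        · exact Or.inr (Finset.add_mem_add hx hy)
        · have := Finset.card_le_one.mp (hN ω) x hx y hy
          rw [this, Bits.add_self] at hxy
          exact absurd hxy.symm (ω k).isSimon.1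
      have h0 := hv0 ω
      by_cases h2 : (ω k).period ∈ D ω + D ω
      · simp only [h2, if_true]
        split_ifs <;> linarith
      · by_cases h3 : (ω k).period ∈ N ω + D ω
        · simp only [h2, h3, if_true, if_false]
          split_ifs <;> linarith
        · rw [if_neg fun h => (h1 h).elim h2 h3, if_neg h2, if_neg h2, if_neg h3, add_zero]
    refine (mul_le_mul_of_nonneg_left (Finset.sum_le_sum fun ω _ => hpt ω) hT).trans ?_
    rw [Finset.sum_add_distrib, mul_add]
    rw [List.length_append, List.length_singleton]
    push_cast
    linarith

/-- The queries `L` leak the period `s` of the `k`-th Simon function, by a collision or by a guess. -/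
def Leaks (k : Fin (d + 1)) (L : List (Fin (d + 1) × Bits (n + n))) (s : Bits n) : Prop :=
  s ∈ queryPoints k L + queryPoints k L ∨ s ∈ queryKeys k L

open Classical in
/-- A classical circuit with access to the truncated oracle is unlikely to leak a period that the
truncation does not depend on. -/
theorem sum_leaks_le {T : ℕ} (hT : 0 ≤ (2 : ℝ) ^ n - 1 - (T : ℝ) ^ 2) (hA : A.length ≤ T)
    (hc : DependsBelow j c) {v : SerialSample d n → ℝ} (hv : DependsBelow j v) (hv0 : ∀ ω, 0 ≤ v ω)
    {k : Fin (d + 1)} (hjk : j ≤ k) :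
    ((2 : ℝ) ^ n - 1 - (T : ℝ) ^ 2) *
      ∑ ω, (if Leaks k (A.queries (truncOracle j ω) (c ω)) (ω k).period then v ω else 0) ≤
      ((T : ℝ) ^ 2 + T) * ∑ ω, v ω := by
  have h1 := sum_collision_le A hT hA hc hv hv0 hjk
  have h2 := sum_score_queries_le A hA hc hjk
    (fun ω s => if s ∈ queryKeys k (A.queries (truncOracle j ω) (c ω)) then v ω else 0)
    (fun ω => T * v ω) (fun ω s => by split_ifs <;> simp [hv0])
    (fun ω => by
      rw [sum_ite_mem_const]
      refine mul_le_mul_of_nonneg_right ?_ (hv0 ω)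
      exact_mod_cast (card_queryKeys_le _ _).trans ((A.length_queries_le _ _).trans hA))
    (fun ω p h1 h2 => by
      funext s
      simp only [hv ω k p hjk, h1])
  have h3 : (A.length * T : ℝ) * ∑ ω, v ω ≤ (T : ℝ) ^ 2 * ∑ ω, v ω := by
    refine mul_le_mul_of_nonneg_right ?_ (Finset.sum_nonneg fun ω _ => hv0 ω)
    rw [sq]
    have : (A.length : ℝ) ≤ T := by exact_mod_cast hA
    gcongr
  rw [← Finset.mul_sum] at h2
  have hpt : ∀ ω, (if Leaks k (A.queries (truncOracle j ω) (c ω)) (ω k).period then v ω else 0) ≤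
      (if (ω k).period ∈ queryPoints k (A.queries (truncOracle j ω) (c ω)) +
          queryPoints k (A.queries (truncOracle j ω) (c ω)) then v ω else 0) +
      (if (ω k).period ∈ queryPoints k (A.queries (truncOracle j ω) (c ω)) +
          queryPoints k (A.queries (truncOracle j ω) (c ω)) then 0 else
        if (ω k).period ∈ queryKeys k (A.queries (truncOracle j ω) (c ω)) then v ω else 0) := by
    intro ω
    have h0 := hv0 ω
    unfold Leaks
    split_ifs <;> first | linarith | tauto
  refine (mul_le_mul_of_nonneg_left (Finset.sum_le_sum fun ω _ => hpt ω) hT).trans ?_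
  rw [Finset.sum_add_distrib]
  linarith

end Truncation

/-! ### Induction over the rounds -/

section Rounds

variable {d n q b : ℕ}

open Classical in
/-- One round with access to the serial oracle, compared with the same round with access to the
truncated oracle: the difference is due to a leak by the classical circuit, or to the weight of the
basis states on which the quantum queries contain a period that the truncation does not depend on. -/
theorem runProb_cons_le (j : ℕ) (final : ClassicalCircuit (Fin (d + 1)) (n + n) (n + 1) b)
    (output : Fin n → Fin b) (t : Bits n) (r : QCRound (Fin (d + 1)) (n + n) (n + 1) q b)
    (rs : List (QCRound (Fin (d + 1)) (n + n) (n + 1) q b)) (ω : SerialSample d n) (c : Bits b)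
    (ψ : QState q) {l : ℝ} (hl : 0 < l) :
    runProb (serialOracle ω) final output t (r :: rs) c ψ ≤
      (∑ k ∈ Finset.univ.filter fun k : Fin (d + 1) => j ≤ k,
        if Leaks k (r.classical.queries (truncOracle j ω) c) (ω k).period then ψ.normSq else 0) +
      (1 + l) * (∑ c', runProb (serialOracle ω) final output t rs c'
        (r.collapse (r.classical.run (truncOracle j ω) c) c' (r.oracleCall.apply (truncOracle j ω)
          ((r.unitary (r.classical.run (truncOracle j ω) c)).apply ψ)))) +
      (1 + l⁻¹) * (4 * ∑ k ∈ Finset.univ.filter fun k : Fin (d + 1) => j ≤ k,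
        if (ω k).period ∈ queryPoints k (r.classical.queries (truncOracle j ω) c) +
          queryPoints k (r.classical.queries (truncOracle j ω) c) then 0 else
        ∑ y, if (ω k).period ∈ queryKeys k (r.oracleCall.queries.map fun Q => (Q.index, Q.input y))
          then ‖(r.unitary (r.classical.run (truncOracle j ω) c)).apply ψ y‖ ^ 2 else 0) := by
  have hl' : 0 < 1 + l⁻¹ := by positivity
  have hn := ψ.normSq_nonneg
  have hA : ∀ k : Fin (d + 1), 0 ≤ if Leaks k (r.classical.queries (truncOracle j ω) c)
      (ω k).period then ψ.normSq else 0 := by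
    intro k
    split_ifs <;> simp [hn]
  have hB : 0 ≤ ∑ c', runProb (serialOracle ω) final output t rs c'
      (r.collapse (r.classical.run (truncOracle j ω) c) c' (r.oracleCall.apply (truncOracle j ω)
        ((r.unitary (r.classical.run (truncOracle j ω) c)).apply ψ))) :=
    Finset.sum_nonneg fun c' _ => runProb_nonneg _ _ _ _ _ _ _
  have hC : ∀ k : Fin (d + 1), 0 ≤ if (ω k).period ∈
      queryPoints k (r.classical.queries (truncOracle j ω) c) +
        queryPoints k (r.classical.queries (truncOracle j ω) c) then (0 : ℝ) else
      ∑ y, if (ω k).period ∈ queryKeys k (r.oracleCall.queries.map fun Q => (Q.index, Q.input y))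
        then ‖(r.unitary (r.classical.run (truncOracle j ω) c)).apply ψ y‖ ^ 2 else 0 := by
    intro k
    split_ifs
    · exact le_rfl
    · exact Finset.sum_nonneg fun y _ => by split_ifs <;> positivity
  by_cases hleak : ∃ k : Fin (d + 1), j ≤ k ∧
      Leaks k (r.classical.queries (truncOracle j ω) c) (ω k).period
  · obtain ⟨k, hjk, hk⟩ := hleak
    have h1 := Finset.single_le_sum (s := Finset.univ.filter fun k : Fin (d + 1) => j ≤ k)
      (fun k _ => hA k) (Finset.mem_filter.mpr ⟨Finset.mem_univ k, hjk⟩)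
    rw [if_pos hk] at h1
    have h2 := runProb_le_normSq (serialOracle ω) final output t (r :: rs) c ψ
    have h3 := Finset.sum_nonneg fun k (_ : k ∈ Finset.univ.filter
      fun k : Fin (d + 1) => j ≤ k) => hC k
    have h4 := mul_nonneg (by positivity : 0 ≤ 1 + l) hB
    have h5 := mul_nonneg hl'.le (mul_nonneg zero_le_four h3)
    linarith
  · push Not at hleak
    have hrun : r.classical.run (serialOracle ω) c = r.classical.run (truncOracle j ω) c := by
      refine (ClassicalCircuit.run_congr fun p hp => ?_).2
      by_contra hne
      obtain ⟨k, hjk, hk⟩ := exists_period_mem_queryKeys hp hne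
      exact hleak k hjk (Or.inr hk)
    rw [runProb_cons, hrun]
    -- Without a leak, the classical circuit ends in the same bits for both oracles, and only the
    -- quantum call makes a difference.
    set c₁ := r.classical.run (truncOracle j ω) c
    set φ := (r.unitary c₁).apply ψ
    have hsplit : r.oracleCall.apply (serialOracle ω) φ = r.oracleCall.apply (truncOracle j ω) φ +
        (r.oracleCall.apply (serialOracle ω) φ - r.oracleCall.apply (truncOracle j ω) φ) := by
      abel
    have h1 : ∑ c', runProb (serialOracle ω) final output t rs c'
          (r.collapse c₁ c' (r.oracleCall.apply (serialOracle ω) φ)) ≤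
        (1 + l) * (∑ c', runProb (serialOracle ω) final output t rs c'
          (r.collapse c₁ c' (r.oracleCall.apply (truncOracle j ω) φ))) +
        (1 + l⁻¹) * (r.oracleCall.apply (serialOracle ω) φ -
          r.oracleCall.apply (truncOracle j ω) φ).normSq := by
      rw [← r.sum_normSq_collapse c₁, Finset.mul_sum, Finset.mul_sum,
        ← Finset.sum_add_distrib]
      refine Finset.sum_le_sum fun c' _ => ?_
      conv_lhs => rw [hsplit, QCRound.collapse_add]
      refine (runProb_add_le_weighted _ _ _ _ _ _ _ _ hl).trans ?_
      gcongr
      exact runProb_le_normSq _ _ _ _ _ _ _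
    have h2 := OracleLayer.normSq_sub_le (serialOracle ω) (truncOracle j ω) r.oracleCall φ
    have h3 : ∑ y, ({y : Bits q | ∃ Q ∈ r.oracleCall.queries,
          serialOracle ω Q.index (Q.input y) ≠ truncOracle j ω Q.index (Q.input y)}.indicator
            (fun y => ‖φ y‖ ^ 2) y) ≤
        ∑ k ∈ Finset.univ.filter fun k : Fin (d + 1) => j ≤ k,
          if (ω k).period ∈ queryPoints k (r.classical.queries (truncOracle j ω) c) +
            queryPoints k (r.classical.queries (truncOracle j ω) c) then 0 else
          ∑ y, if (ω k).period ∈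
            queryKeys k (r.oracleCall.queries.map fun Q => (Q.index, Q.input y))
            then ‖φ y‖ ^ 2 else 0 := by
      have h4 : ∀ k ∈ Finset.univ.filter fun k : Fin (d + 1) => j ≤ k, (ω k).period ∉
          queryPoints k (r.classical.queries (truncOracle j ω) c) +
            queryPoints k (r.classical.queries (truncOracle j ω) c) := fun k hk hmem =>
        hleak k (Finset.mem_filter.mp hk).2 (Or.inl hmem)
      rw [Finset.sum_congr rfl fun k hk => if_neg (h4 k hk), Finset.sum_comm]
      refine Finset.sum_le_sum fun y _ => ?_
      have h5 : ∀ k : Fin (d + 1), 0 ≤ if (ω k).period ∈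
          queryKeys k (r.oracleCall.queries.map fun Q => (Q.index, Q.input y))
          then ‖φ y‖ ^ 2 else 0 := fun k => by split_ifs <;> positivity
      refine Set.indicator_apply_le' (fun hy => ?_) fun _ => Finset.sum_nonneg fun k _ => h5 k
      obtain ⟨Q, hQ, hne⟩ := hy
      obtain ⟨k, hjk, hk⟩ := exists_period_mem_queryKeys (p := (Q.index, Q.input y))
        (List.mem_map_of_mem (f := fun Q => (Q.index, Q.input y)) hQ) hne
      have h6 := Finset.single_le_sum (s := Finset.univ.filter fun k : Fin (d + 1) => j ≤ k)
        (fun k _ => h5 k) (Finset.mem_filter.mpr ⟨Finset.mem_univ k, hjk⟩)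
      rwa [if_pos hk] at h6
    have h7 := Finset.sum_nonneg fun k (_ : k ∈ Finset.univ.filter
      fun k : Fin (d + 1) => j ≤ k) => hA k
    have h8 := mul_le_mul_of_nonneg_left (h2.trans (mul_le_mul_of_nonneg_left h3 zero_le_four))
      hl'.le
    linarith

/-- A recursive bound on the probability to find the last period in `r` more rounds; the factor
`(2 ^ n - 1 - T ^ 2)⁻¹` is left out. -/
noncomputable def roundsBound (d T : ℕ) (l : ℝ) : ℕ → ℝ
  | 0 => (T : ℝ) ^ 2 + 1
  | r + 1 => (d + 1) * ((T : ℝ) ^ 2 + T) + (1 + l⁻¹) * (4 * ((d + 1) * T)) +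
      (1 + l) * roundsBound d T l r

/-- The final classical circuit cannot find the period of the last Simon function, to which it alone
has access: it neither queries a collision nor guesses the period without one. -/
theorem sum_runProb_nil_le {T : ℕ} (hT : 0 ≤ (2 : ℝ) ^ n - 1 - (T : ℝ) ^ 2)
    (final : ClassicalCircuit (Fin (d + 1)) (n + n) (n + 1) b)
    (hfinal : final.length ≤ T) (output : Fin n → Fin b) (c : SerialSample d n → Bits b)
    (ψ : SerialSample d n → QState q) (hc : DependsBelow d c) (hψ : DependsBelow d ψ) :
    ((2 : ℝ) ^ n - 1 - (T : ℝ) ^ 2) * ∑ ω, runProb (serialOracle ω) final output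
        (ω (Fin.last d)).period [] (c ω) (ψ ω) ≤
      ((T : ℝ) ^ 2 + 1) * ∑ ω, (ψ ω).normSq := by
  classical
  have hv : DependsBelow d fun ω => (ψ ω).normSq := fun ω k p hk => by
    dsimp only
    rw [hψ ω k p hk]
  have hv0 : ∀ ω, 0 ≤ (ψ ω).normSq := fun ω => (ψ ω).normSq_nonneg
  have hlast : d ≤ (Fin.last d : ℕ) := le_rfl
  have h1 := sum_collision_le final hT hfinal hc hv hv0 hlast
  have h2 := sum_score_queries_le final hfinal hc hlast
    (fun ω s => if (fun i => final.run (truncOracle d ω) (c ω) (output i)) = s then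
      (ψ ω).normSq else 0)
    (fun ω => (ψ ω).normSq) (fun ω s => by split_ifs <;> simp [hv0]) (fun ω => by simp)
    (fun ω p h1 h2 => by
      funext s
      rw [h2, hψ ω _ p hlast])
  have h3 : (final.length * T : ℝ) * ∑ ω, (ψ ω).normSq ≤ (T : ℝ) ^ 2 * ∑ ω, (ψ ω).normSq := by
    refine mul_le_mul_of_nonneg_right ?_ (Finset.sum_nonneg fun ω _ => hv0 ω)
    rw [sq]
    have : (final.length : ℝ) ≤ T := by exact_mod_cast hfinal
    gcongr
  -- The truncation after the last sub-oracle is the serial oracle itself.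
  have hpt : ∀ ω, runProb (serialOracle ω) final output (ω (Fin.last d)).period [] (c ω) (ψ ω) ≤
      (if (ω (Fin.last d)).period ∈
          queryPoints (Fin.last d) (final.queries (truncOracle d ω) (c ω)) +
          queryPoints (Fin.last d) (final.queries (truncOracle d ω) (c ω)) then
        (ψ ω).normSq else 0) +
      (if (ω (Fin.last d)).period ∈
          queryPoints (Fin.last d) (final.queries (truncOracle d ω) (c ω)) +
          queryPoints (Fin.last d) (final.queries (truncOracle d ω) (c ω)) then 0 else
        if (fun i => final.run (truncOracle d ω) (c ω) (output i)) = (ω (Fin.last d)).period then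
          (ψ ω).normSq else 0) := by
    intro ω
    rw [runProb, serialOracle_eq_truncOracle]
    have h0 := hv0 ω
    change (if _ then (ψ ω).normSq else 0) ≤ _
    split_ifs <;> linarith
  refine (mul_le_mul_of_nonneg_left (Finset.sum_le_sum fun ω _ => hpt ω) hT).trans ?_
  rw [Finset.sum_add_distrib]
  linarith

/-- The success probability of the remaining rounds, if the classical bits and the state depend on
the first `j` Simon functions only, as they do when the first `j` rounds have been run with access to
truncated oracles. -/
theorem sum_runProb_le {T : ℕ} (hT : 0 ≤ (2 : ℝ) ^ n - 1 - (T : ℝ) ^ 2)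
    (final : ClassicalCircuit (Fin (d + 1)) (n + n) (n + 1) b)
    (hfinal : final.length ≤ T) (hq : q ≤ T) (output : Fin n → Fin b) {l : ℝ} (hl : 0 < l)
    (rs : List (QCRound (Fin (d + 1)) (n + n) (n + 1) q b))
    (hrs : ∀ r ∈ rs, r.classical.length ≤ T) (j : ℕ) (hj : j + rs.length = d)
    (c : SerialSample d n → Bits b) (ψ : SerialSample d n → QState q) (hc : DependsBelow j c)
    (hψ : DependsBelow j ψ) :
    ((2 : ℝ) ^ n - 1 - (T : ℝ) ^ 2) * ∑ ω, runProb (serialOracle ω) final output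
        (ω (Fin.last d)).period rs (c ω) (ψ ω) ≤
      roundsBound d T l rs.length * ∑ ω, (ψ ω).normSq := by
  classical
  induction rs generalizing j c ψ with
  | nil =>
    obtain rfl : j = d := hj
    exact sum_runProb_nil_le hT final hfinal output c ψ hc hψ
  | cons r rs ih =>
    have hr := hrs r List.mem_cons_self
    have hv : DependsBelow j fun ω => (ψ ω).normSq := fun ω k p hk => by
      dsimp only
      rw [hψ ω k p hk]
    have hv0 : ∀ ω, 0 ≤ (ψ ω).normSq := fun ω => (ψ ω).normSq_nonneg
    set S := ∑ ω, (ψ ω).normSq with hS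
    have hS0 : 0 ≤ S := Finset.sum_nonneg fun ω _ => hv0 ω
    set K := (2 : ℝ) ^ n - 1 - (T : ℝ) ^ 2 with hK
    have hcard : ((Finset.univ.filter fun k : Fin (d + 1) => j ≤ k).card : ℝ) ≤ d + 1 := by
      have := Finset.card_le_univ (Finset.univ.filter fun k : Fin (d + 1) => j ≤ k)
      rw [Fintype.card_fin] at this
      exact_mod_cast this
    let c₁ : SerialSample d n → Bits b := fun ω => r.classical.run (truncOracle j ω) (c ω)
    let φ : SerialSample d n → QState q := fun ω => (r.unitary (c₁ ω)).apply (ψ ω)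
    have hc₁ : DependsBelow (j + 1) c₁ := fun ω k p hk => by
      simp only [c₁]
      rw [truncOracle_dependsBelow j ω k p hk, hc ω k p (by omega)]
    have hφ : DependsBelow (j + 1) φ := fun ω k p hk => by
      simp only [φ]
      rw [hc₁ ω k p hk, hψ ω k p (by omega)]
    have hφn : ∀ ω, (φ ω).normSq = (ψ ω).normSq := fun ω => Layer.normSq_apply _ _
    have hleak : K * ∑ ω, ∑ k ∈ Finset.univ.filter fun k : Fin (d + 1) => j ≤ k,
        (if Leaks k (r.classical.queries (truncOracle j ω) (c ω)) (ω k).period then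
          (ψ ω).normSq else 0) ≤ (d + 1) * ((T : ℝ) ^ 2 + T) * S := by
      rw [Finset.sum_comm, Finset.mul_sum]
      refine (Finset.sum_le_card_nsmul _ _ (((T : ℝ) ^ 2 + T) * S) fun k hk => ?_).trans ?_
      · exact sum_leaks_le r.classical hT hr hc hv hv0 (Finset.mem_filter.mp hk).2
      · rw [nsmul_eq_mul, mul_assoc]
        gcongr
    have hmain : K * ∑ ω, ∑ c', runProb (serialOracle ω) final output (ω (Fin.last d)).period rs c'
        (r.collapse (c₁ ω) c' (r.oracleCall.apply (truncOracle j ω) (φ ω))) ≤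
        roundsBound d T l rs.length * S := by
      rw [Finset.sum_comm, Finset.mul_sum]
      refine (Finset.sum_le_sum fun c' _ => ih (fun r hr => hrs r (List.mem_cons_of_mem _ hr))
        (j + 1) (by rw [List.length_cons] at hj; omega) (fun _ => c') (fun ω =>
          r.collapse (c₁ ω) c' (r.oracleCall.apply (truncOracle j ω) (φ ω)))
        (fun _ _ _ _ => rfl) fun ω k p hk => ?_).trans ?_
      · dsimp only
        rw [hc₁ ω k p hk, hφ ω k p hk, truncOracle_dependsBelow j ω k p hk]
      · rw [← Finset.mul_sum, Finset.sum_comm]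
        simp only [QCRound.sum_normSq_collapse, OracleLayer.normSq_apply, hφn]
        exact le_rfl
    have hquant : K * ∑ ω, ∑ k ∈ Finset.univ.filter fun k : Fin (d + 1) => j ≤ k,
        (if (ω k).period ∈ queryPoints k (r.classical.queries (truncOracle j ω) (c ω)) +
          queryPoints k (r.classical.queries (truncOracle j ω) (c ω)) then 0 else
        ∑ y, if (ω k).period ∈ queryKeys k (r.oracleCall.queries.map fun Q => (Q.index, Q.input y))
          then ‖φ ω y‖ ^ 2 else 0) ≤ (d + 1) * T * S := by
      rw [Finset.sum_comm, Finset.mul_sum]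
      refine (Finset.sum_le_card_nsmul _ _ (T * S) fun k hk => ?_).trans ?_
      · have hjk := (Finset.mem_filter.mp hk).2
        have h := sum_score_queries_le r.classical hr hc hjk
          (fun ω s => ∑ y, if s ∈ queryKeys k
            (r.oracleCall.queries.map fun Q => (Q.index, Q.input y)) then ‖φ ω y‖ ^ 2 else 0)
          (fun ω => T * (ψ ω).normSq)
          (fun ω s => Finset.sum_nonneg fun y _ => by split_ifs <;> positivity)
          (fun ω => by
            rw [Finset.sum_comm, ← hφn, QState.normSq, Finset.mul_sum]
            refine Finset.sum_le_sum fun y _ => ?_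
            rw [sum_ite_mem_const]
            refine mul_le_mul_of_nonneg_right ?_ (by positivity)
            have h1 := card_queryKeys_le k
              (r.oracleCall.queries.map fun Q => (Q.index, Q.input y))
            rw [List.length_map] at h1
            exact_mod_cast h1.trans ((r.oracleCall.length_queries_le n.succ_pos).trans hq))
          (fun ω p h1 h2 => by
            funext s
            simp only [φ, c₁]
            rw [h2, hψ ω k p hjk])
        rwa [← Finset.mul_sum] at h
      · rw [nsmul_eq_mul, mul_assoc]
        gcongr
    refine (mul_le_mul_of_nonneg_left (Finset.sum_le_sum fun ω _ =>
      runProb_cons_le j final output _ r rs ω (c ω) (ψ ω) hl) hT).trans ?_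
    simp only [Finset.sum_add_distrib, ← Finset.mul_sum]
    have e1 := mul_le_mul_of_nonneg_left hmain (by positivity : 0 ≤ 1 + l)
    have e2 := mul_le_mul_of_nonneg_left hquant (by positivity : 0 ≤ (1 + l⁻¹) * 4)
    rw [List.length_cons, roundsBound]
    simp only [c₁, φ] at e1 e2
    linarith

end Rounds

/-! ### The final estimate -/

theorem roundsBound_le (d T : ℕ) {l : ℝ} (hl : 0 < l) (r : ℕ) :
    roundsBound d T l r ≤ (1 + l) ^ r * ((T : ℝ) ^ 2 + 1 +
      r * ((d + 1) * ((T : ℝ) ^ 2 + T) + (1 + l⁻¹) * (4 * ((d + 1) * T)))) := by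
  induction r with
  | zero => simp [roundsBound]
  | succ r ih =>
    have h1 : 0 ≤ (d + 1) * ((T : ℝ) ^ 2 + T) + (1 + l⁻¹) * (4 * ((d + 1) * T)) := by positivity
    have h2 : 1 ≤ (1 + l) ^ (r + 1) := one_le_pow₀ (by linarith)
    have h3 := mul_le_mul_of_nonneg_left ih (by positivity : 0 ≤ 1 + l)
    have h4 := le_mul_of_one_le_left h1 h2
    rw [roundsBound]
    push_cast
    rw [pow_succ (1 + l)] at h4 ⊢
    linarith

/-- The loss `l = 1 / (d + 1)` per round keeps the accumulated factor `(1 + l) ^ d` bounded. -/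
theorem roundsBound_inv_le (d T : ℕ) :
    roundsBound d T ((d : ℝ) + 1)⁻¹ d ≤ 3 * ((T : ℝ) ^ 2 + 1 +
      d * ((d + 1) * ((T : ℝ) ^ 2 + T) + (d + 2) * (4 * ((d + 1) * T)))) := by
  have hd : (0 : ℝ) < d + 1 := by positivity
  refine (roundsBound_le d T (inv_pos.mpr hd) d).trans ?_
  rw [inv_inv, show (1 : ℝ) + (d + 1) = d + 2 by ring]
  refine mul_le_mul_of_nonneg_right ?_ (by positivity)
  calc (1 + ((d : ℝ) + 1)⁻¹) ^ d ≤ (Real.exp ((d : ℝ) + 1)⁻¹) ^ d := by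
        gcongr
        rw [add_comm]
        exact Real.add_one_le_exp _
    _ = Real.exp (d * ((d : ℝ) + 1)⁻¹) := (Real.exp_nat_mul _ _).symm
    _ ≤ Real.exp 1 := by
        gcongr
        rw [← div_eq_mul_inv, div_le_one hd]
        linarith
    _ ≤ 3 := Real.exp_one_lt_d9.le.trans (by norm_num)

theorem successProb_le {d n T : ℕ} (C : QCCircuit (Fin (d + 1)) (n + n) (n + 1) d n)
    (hC : C.SizeAtMost T) (hT : 0 < (2 : ℝ) ^ n - 1 - (T : ℝ) ^ 2) {l : ℝ} (hl : 0 < l) :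
    successProb C ≤ roundsBound d T l d / ((2 : ℝ) ^ n - 1 - (T : ℝ) ^ 2) := by
  have h := sum_runProb_le hT.le C.final hC.2.2.2 hC.1 C.output hl (List.ofFn C.rounds)
    (fun r hr => by
      obtain ⟨i, rfl⟩ := (List.mem_ofFn' _ _).mp hr
      exact hC.2.2.1 i)
    0 (by simp) (fun _ => 0) (fun _ => Pi.single 0 1) (fun _ _ _ _ => rfl) (fun _ _ _ _ => rfl)
  have hn : QState.normSq (Pi.single (0 : Bits C.qubits) (1 : ℂ)) = 1 := by
    rw [QState.normSq, Finset.sum_eq_single 0] <;> simp +contextual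
  have hB : ∀ r, 0 ≤ roundsBound d T l r := by
    intro r
    induction r with
    | zero => simp only [roundsBound]; positivity
    | succ r ih => simp only [roundsBound]; positivity
  rw [List.length_ofFn, hn, Finset.sum_const, nsmul_eq_mul, mul_one, Finset.card_univ,
    mul_comm, ← le_div_iff₀ hT] at h
  refine div_le_of_le_mul₀ (by positivity) (div_nonneg (hB d) hT.le) (h.trans_eq ?_)
  ring

theorem eventually_two_mul_eval_le (R : Polynomial ℕ) :
    ∀ᶠ n : ℕ in Filter.atTop, 2 * ((R.eval n : ℕ) : ℝ) ≤ (2 : ℝ) ^ ((n : ℝ) / 2) := by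
  have hlog : 0 < Real.log 2 / 2 := by have := Real.log_pos one_lt_two; positivity
  let p : Polynomial ℝ := (R.map (Nat.castRingHom ℝ)).comp
    (Polynomial.C (Real.log 2 / 2)⁻¹ * Polynomial.X)
  have h1 : Filter.Tendsto (fun n : ℕ => Real.log 2 / 2 * (n : ℝ)) Filter.atTop Filter.atTop :=
    tendsto_natCast_atTop_atTop.const_mul_atTop hlog
  have h2 := (p.tendsto_div_exp_atTop.comp h1).eventually_lt_const (show (0 : ℝ) < 1 / 2 by norm_num)
  filter_upwards [h2] with n hn
  have h3 : p.eval (Real.log 2 / 2 * (n : ℝ)) = ((R.eval n : ℕ) : ℝ) := by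
    simp only [p, Polynomial.eval_comp, Polynomial.eval_mul, Polynomial.eval_C, Polynomial.eval_X]
    rw [inv_mul_cancel_left₀ hlog.ne', Polynomial.eval_natCast_map]
    rfl
  rw [Function.comp, h3, div_lt_iff₀ (Real.exp_pos _),
    show Real.log 2 / 2 * (n : ℝ) = Real.log 2 * (n / 2) by ring,
    ← Real.rpow_def_of_pos two_pos] at hn
  linarith

end SerialSimon

theorem mainTheorem1 (d : ℕ → ℕ) (hd : ∃ p : Polynomial ℕ, ∀ n, d n ≤ p.eval n)
    (B : ∀ n : ℕ, SerialSimon.QCCircuit (Fin (d n + 1)) (n + n) (n + 1) (d n) n)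
    (hB : ∃ p : Polynomial ℕ, ∀ n, (B n).SizeAtMost (p.eval n)) :
    ∃ c : ℝ, 0 < c ∧ ∀ᶠ n : ℕ in Filter.atTop,
      SerialSimon.successProb (B n) ≤ (2 : ℝ) ^ (-(c * (n : ℝ))) := by
  obtain ⟨P, hP⟩ := hd
  obtain ⟨p, hp⟩ := hB
  let R : Polynomial ℕ := 3 * (p ^ 2 + 1 +
    P * ((P + 1) * (p ^ 2 + p) + (P + 2) * (4 * ((P + 1) * p))))
  refine ⟨1 / 2, by norm_num, ?_⟩
  filter_upwards [SerialSimon.eventually_two_mul_eval_le R] with n hn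
  set T := p.eval n with hT
  set D := P.eval n with hD
  have hR : ((R.eval n : ℕ) : ℝ) = 3 * ((T : ℝ) ^ 2 + 1 + (D : ℝ) * (((D : ℝ) + 1) *
      ((T : ℝ) ^ 2 + T) + ((D : ℝ) + 2) * (4 * (((D : ℝ) + 1) * T)))) := by
    simp [R, ← hT, ← hD]
  have hdP : (d n : ℝ) ≤ (D : ℝ) := by exact_mod_cast hP n
  have hbound : SerialSimon.roundsBound (d n) T ((d n : ℝ) + 1)⁻¹ (d n) ≤ ((R.eval n : ℕ) : ℝ) := by
    refine (SerialSimon.roundsBound_inv_le (d n) T).trans ?_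
    rw [hR]
    gcongr
  have hTR : (T : ℝ) ^ 2 + 1 ≤ ((R.eval n : ℕ) : ℝ) := by
    rw [hR]
    have h1 : 0 ≤ (D : ℝ) * (((D : ℝ) + 1) *
      ((T : ℝ) ^ 2 + T) + ((D : ℝ) + 2) * (4 * (((D : ℝ) + 1) * T))) := by positivity
    have h2 : 0 ≤ (T : ℝ) ^ 2 := by positivity
    linarith
  have hsq : (2 : ℝ) ^ ((n : ℝ) / 2) * (2 : ℝ) ^ ((n : ℝ) / 2) = 2 ^ n := by
    rw [← Real.rpow_add two_pos, add_halves, Real.rpow_natCast]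
  have hroot : 1 ≤ (2 : ℝ) ^ ((n : ℝ) / 2) := Real.one_le_rpow one_le_two (by positivity)
  -- Both `T ^ 2 + 1` and the numerator of the bound are at most `2 ^ (n / 2) / 2`.
  have hK : (2 : ℝ) ^ n / 2 ≤ 2 ^ n - 1 - (T : ℝ) ^ 2 := by
    have := le_mul_of_one_le_left (zero_le_one.trans hroot) hroot
    linarith
  have hN : (0 : ℝ) < 2 ^ n / 2 := by positivity
  refine (SerialSimon.successProb_le (B n) (hp n) (hN.trans_le hK)
    (l := ((d n : ℝ) + 1)⁻¹) (by positivity)).trans ?_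
  calc SerialSimon.roundsBound (d n) T ((d n : ℝ) + 1)⁻¹ (d n) / (2 ^ n - 1 - (T : ℝ) ^ 2)
      ≤ ((R.eval n : ℕ) : ℝ) / (2 ^ n / 2) := by gcongr
    _ ≤ (2 : ℝ) ^ ((n : ℝ) / 2) / 2 ^ n := by
        rw [div_div_eq_mul_div, mul_comm]
        gcongr
    _ = (2 : ℝ) ^ (-(1 / 2 * (n : ℝ))) := by
        rw [← hsq, div_mul_cancel_left₀ (by positivity), ← Real.rpow_neg zero_le_two]
        congr 1
        ring
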